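/- Let $n\ge 3$, let $\Omega\subset\mathbb R^n$ be a bounded domain with $\partial\Omega\in C^{2,1}$, let $T>0$, $Q=\Omega\times(0,T)$ and $S=\partial\Omega\times(0,T)$. For $p\in(1,\infty)$ let $W^{2,1}_p(Q)$ be the space of functions $u\in L^p(Q)$ whose weak derivatives $D_iu$, $D_{ij}u$ ($1\le i,j\le n$) and $u_t$ exist and belong to $L^p(Q)$. For $0<\alpha<1$ let $C^{0,\alpha}(\bar Q)$ be the space of functions on $\bar Q$ that are bounded and Hölder continuous with exponent $\alpha$ with respect to the parabolic distance, i.e. $$|v(x,t)-v(y,s)|\le C\left(|x-y|+|t-s|^{1/2}\right)^{\alpha}\qquad\text{for all }(x,t),(y,s)\in\bar Q .$$ Let $u\in W^{2,1}_p(Q)$ be a strong solution of the oblique derivative problem $$u_t-\sum_{i,j=1}^n a^{ij}(x,t)D_{ij}u=f\ \text{ in }Q,\qquad u(x,0)=\psi(x)\ \text{ on }\Omega,\qquad \sum_{i=1}^n\ell^i(x,t)D_iu=\varphi\ \text{ on }S$$ (with arbitrary real-valued coefficients $a^{ij},\ell^i$ and data $f,\psi,\varphi$), that is, the equation holds almost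 everywhere in $Q$, and the initial and boundary conditions hold almost everywhere in the sense of traces. Then: (i) if $\frac{n+2}{2}<p\le n+2$, then for every $\alpha$ with $0<\alpha<2-\frac{n+2}{p}$ the function $u$ coincides almost everywhere in $Q$ with a function of class $C^{0,\alpha}(\bar Q)$; (ii) if $p>n+2$, then for every $\beta$ with $0<\beta<1-\frac{n+2}{p}$ each of the weak derivatives $D_iu$, $1\le i\le n$, coincides almost everywhere in $Q$ with a function of class $C^{0,\beta}(\bar Q)$. -/

import Mathlib

open MeasureTheory Set Filter Topology
open scoped ContDiff ENNReal NNReal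

noncomputable section

namespace ParabolicPoincare

/-- Euclidean space `ℝⁿ`. -/
abbrev E (n : ℕ) : Type := EuclideanSpace ℝ (Fin n)

/-- Space-time `ℝⁿ × ℝ`; a point is `z = (x, t)`. -/
abbrev ST (n : ℕ) : Type := E n × ℝ

/-- `Ω` is a bounded domain (nonempty, open, connected) with boundary of class `C^{2,1}`:
near every boundary point, in suitable Cartesian coordinates, `Ω` is the set of points
lying below the graph of a function `g` with Lipschitz continuous second derivatives.
Here `ν` is the direction of the vertical axis, `inner ℝ y ν` is the height of `y`, and
`y - inner ℝ y ν • ν` is the projection of `y` to the horizontal hyperplane. -/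
structure IsBoundedC21Domain {n : ℕ} (Ω : Set (E n)) : Prop where
  isOpen : IsOpen Ω
  isConnected : IsConnected Ω
  isBounded : Bornology.IsBounded Ω
  boundary : ∀ x₀ ∈ frontier Ω, ∃ (ν : E n) (r : ℝ) (g : E n → ℝ) (K : ℝ≥0),
    ‖ν‖ = 1 ∧ 0 < r ∧ ContDiff ℝ 2 g ∧ LipschitzWith K (iteratedFDeriv ℝ 2 g) ∧
    ∀ y ∈ Metric.ball x₀ r,
      (y ∈ Ω ↔ inner ℝ y ν < g (y - (inner ℝ y ν : ℝ) • ν))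

/-- The cylinder `Q = Ω × (0,T)`. -/
def cyl {n : ℕ} (Ω : Set (E n)) (T : ℝ) : Set (ST n) := Ω ×ˢ Ioo 0 T

/-- Lebesgue measure on the cylinder `Q`. -/
def cylMeasure {n : ℕ} (Ω : Set (E n)) (T : ℝ) : Measure (ST n) :=
  volume.restrict (cyl Ω T)

/-- The surface measure on the lateral boundary `S = ∂Ω × (0,T)`: the product of the
`(n-1)`-dimensional Hausdorff measure on `∂Ω` and of Lebesgue measure on `(0,T)`. -/
def latMeasure {n : ℕ} (Ω : Set (E n)) (T : ℝ) : Measure (ST n) :=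
  ((Measure.hausdorffMeasure ((n : ℝ) - 1) : Measure (E n)).restrict (frontier Ω)).prod
    (volume.restrict (Ioo 0 T))

/-- The spatial unit direction `eᵢ` in space-time. -/
def ex {n : ℕ} (i : Fin n) : ST n := (EuclideanSpace.single i 1, 0)

/-- The time direction in space-time. -/
def et {n : ℕ} : ST n := (0, 1)

/-- The classical directional derivative `∂_e w`. -/
def dirDeriv {n : ℕ} (e : ST n) (w : ST n → ℝ) (z : ST n) : ℝ := fderiv ℝ w z e

/-- `v` is the weak (distributional) derivative of `u` in the direction `e` in the
open set `G`. -/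
structure IsWeakDeriv {n : ℕ} (G : Set (ST n)) (e : ST n) (u v : ST n → ℝ) : Prop where
  locInt : LocallyIntegrableOn u G
  locInt_deriv : LocallyIntegrableOn v G
  integral_eq : ∀ η : ST n → ℝ, ContDiff ℝ ∞ η → HasCompactSupport η → tsupport η ⊆ G →
    ∫ z in G, u z * dirDeriv e η z = - ∫ z in G, v z * η z

/-- `u ∈ W^{2,1}_p(Q)`, with weak derivatives `D_i u = Du i`, `D_{ij} u = D2u i j`
and `u_t = ut`, all of them in `L^p(Q)`. -/
structure HasW21Derivs {n : ℕ} (Ω : Set (E n)) (T p : ℝ) (u : ST n → ℝ)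
    (Du : Fin n → ST n → ℝ) (D2u : Fin n → Fin n → ST n → ℝ) (ut : ST n → ℝ) : Prop where
  memLp : MemLp u (ENNReal.ofReal p) (cylMeasure Ω T)
  memLp_Du : ∀ i, MemLp (Du i) (ENNReal.ofReal p) (cylMeasure Ω T)
  memLp_D2u : ∀ i j, MemLp (D2u i j) (ENNReal.ofReal p) (cylMeasure Ω T)
  memLp_ut : MemLp ut (ENNReal.ofReal p) (cylMeasure Ω T)
  deriv_Du : ∀ i, IsWeakDeriv (cyl Ω T) (ex i) u (Du i)
  deriv_D2u : ∀ i j, IsWeakDeriv (cyl Ω T) (ex j) (Du i) (D2u i j)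
  deriv_ut : IsWeakDeriv (cyl Ω T) et u ut

/-- `u(x,0) = ψ(x)` on `Ω` in the sense of traces: for almost every `x ∈ Ω`, `ψ x` is the
limit, in the mean, of `u(x,t)` as `t → 0+`. -/
def HasInitialTrace {n : ℕ} (Ω : Set (E n)) (u : ST n → ℝ) (ψ : E n → ℝ) : Prop :=
  ∀ᵐ x ∂(volume.restrict Ω),
    Tendsto (fun h : ℝ => ⨍⁻ t, ‖u (x, t) - ψ x‖ₑ ∂(volume.restrict (Ioo 0 h))) (𝓝[>] 0) (𝓝 0)

/-- `g` is the trace of `w` on the lateral boundary `S`: for almost every `(x,t) ∈ S`,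
`g (x,t)` is the limit, in the mean over `B_r(x) ∩ Ω`, of `w(·,t)` as `r → 0+`. (For
functions `w(·,t)` in `W^{1,p}(Ω)` this is the usual Sobolev trace.) -/
def HasLateralTrace {n : ℕ} (Ω : Set (E n)) (T : ℝ) (w g : ST n → ℝ) : Prop :=
  ∀ᵐ z ∂(latMeasure Ω T),
    Tendsto (fun r : ℝ => ⨍⁻ y, ‖w (y, z.2) - g z‖ₑ ∂(volume.restrict (Metric.ball z.1 r ∩ Ω)))
      (𝓝[>] 0) (𝓝 0)

/-- `u` is a strong solution in `W^{2,1}_p(Q)` of the problem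
`u_t - a^{ij} D_{ij} u = f` in `Q`, `u(x,0) = ψ(x)` on `Ω`, `ℓ^i D_i u = φ` on `S`:
the equation holds almost everywhere in `Q`, the initial and boundary conditions hold in
the sense of traces. -/
def IsStrongSolution {n : ℕ} (Ω : Set (E n)) (T p : ℝ)
    (a : Fin n → Fin n → ST n → ℝ) (l : Fin n → ST n → ℝ)
    (f : ST n → ℝ) (ψ : E n → ℝ) (φ : ST n → ℝ) (u : ST n → ℝ) : Prop :=
  ∃ (Du : Fin n → ST n → ℝ) (D2u : Fin n → Fin n → ST n → ℝ) (ut : ST n → ℝ),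
    HasW21Derivs Ω T p u Du D2u ut ∧
    -- the equation
    (∀ᵐ z ∂(cylMeasure Ω T), ut z - ∑ i, ∑ j, a i j z * D2u i j z = f z) ∧
    -- the initial condition
    HasInitialTrace Ω u ψ ∧
    -- the boundary condition; `g i` is the trace of `D_i u` on `S`
    (∃ g : Fin n → ST n → ℝ, (∀ i, HasLateralTrace Ω T (Du i) (g i)) ∧
      ∀ᵐ z ∂(latMeasure Ω T), ∑ i, l i z * g i z = φ z)

/-- `v ∈ C^{0,α}(A)` with respect to the parabolic distance `|x-y| + |t-s|^{1/2}`: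
`v` is bounded and Hölder continuous with exponent `α` on `A`. -/
def ParabolicHolderOn {n : ℕ} (α : ℝ) (v : ST n → ℝ) (A : Set (ST n)) : Prop :=
  ∃ C : ℝ, (∀ z ∈ A, |v z| ≤ C) ∧
    ∀ z ∈ A, ∀ z' ∈ A, |v z - v z'| ≤ C * (‖z.1 - z'.1‖ + √|z.2 - z'.2|) ^ α

end ParabolicPoincare

end

/-!
The statement is a parabolic Sobolev embedding: only membership of `u` in `W^{2,1}_p(Q)` matters,
not the equation or the initial and boundary conditions.

The proof does not extend `u` beyond `Q`. Near every point of the closure of `Q` there are an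
off-centre ball `B(b, δ)` of profiles and a scale `h` such that `z + dil s (B(b, δ)) ⊆ Q` for all
nearby `z` in the closure and all `0 < s ≤ h`, where `dil s (x, t) = (s x, s² t)`: in space this
is the interior cone condition (`IsBoundedC21Domain.exists_cone`), in time one looks forward or
backward. For a smooth profile `G` supported in `B(b, δ)` let `pairing Q w G s z` be the average of
`w` over `z + dil s (B(b, δ))` with the weight `G`. Three facts about these averages are used.

* For `w ∈ L^p` they are `O(s ^ (-(n + 2) / p))` (`exists_abs_pairing_le_of_memLp`).
* Weak derivatives can be moved between `w` and `G`; each costs a factor `s` in space and `s²` in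
  time (`IsWeakDeriv.pairing_ex`, `IsWeakDeriv.pairing_et`).
* The derivative of the average with respect to `s` is `-1 / s` times an average whose profile is
  a sum of derivatives of test functions (`hasDerivAt_pairing_scale`), and the derivatives with
  respect to `z` have the same form (`hasDerivAt_pairing_translate`).

So everything is controlled by the averages with profile `∂_e G`. If these are `O(s ^ γ)`
(`DerivGrowth`) and `γ < 0`, integration in `s` shows that all averages are `O(s ^ γ)`. If
`0 < γ ≤ 1`, the averages converge at the rate `s ^ γ`, the limit is `γ`-Hölder continuous for the
parabolic distance (`DerivGrowth.exists_limit`), and it is equal to `w` almost everywhere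
(`ae_eq_of_pairing_limit`).

For `w = D_i u` the order is `γ = 1 - (n + 2) / p`, because `∂_t D_i u = D_i u_t` and the spatial
derivative here can be moved to the profile. This gives the second part. In the first part one
takes `γ = α - 1 < 0` for `D_i u`, and then the averages of `D_i u` are `O(s ^ (α - 1))`, so that
`u` has order `α`. A Lebesgue number argument and a McShane extension make the local estimates
global (`exists_holder_of_local`).
-/

noncomputable section

namespace ParabolicPoincare

/-! ### Parabolic dilations and rescaled test functions -/

/-- The parabolic dilation `(x, t) ↦ (s x, s² t)` of space-time. -/
def dil {n : ℕ} (s : ℝ) : ST n →L[ℝ] ST n :=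
  (s • ContinuousLinearMap.id ℝ (E n)).prodMap (s ^ 2 • ContinuousLinearMap.id ℝ ℝ)

lemma dil_apply {n : ℕ} (s : ℝ) (z : ST n) : dil s z = (s • z.1, s ^ 2 * z.2) := rfl

lemma dil_dil {n : ℕ} (s r : ℝ) (z : ST n) : dil s (dil r z) = dil (s * r) z := by
  simp only [dil_apply, smul_smul, mul_pow, mul_assoc]

lemma dil_one {n : ℕ} (z : ST n) : dil 1 z = z := by simp [dil_apply]

lemma dil_inv_dil {n : ℕ} {s : ℝ} (hs : s ≠ 0) (z : ST n) : dil s⁻¹ (dil s z) = z := by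
  rw [dil_dil, inv_mul_cancel₀ hs, dil_one]

lemma dil_dil_inv {n : ℕ} {s : ℝ} (hs : s ≠ 0) (z : ST n) : dil s (dil s⁻¹ z) = z := by
  rw [dil_dil, mul_inv_cancel₀ hs, dil_one]

/-- A smooth function supported in the set `B`. -/
structure IsTest {n : ℕ} (B : Set (ST n)) (G : ST n → ℝ) : Prop where
  smooth : ContDiff ℝ ∞ G
  supp : tsupport G ⊆ B

lemma IsTest.hasCompactSupport {n : ℕ} {b : ST n} {δ : ℝ} {G : ST n → ℝ}
    (h : IsTest (Metric.ball b δ) G) : HasCompactSupport G :=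
  Metric.isCompact_of_isClosed_isBounded (isClosed_tsupport G) (Metric.isBounded_ball.subset h.supp)

lemma IsTest.dirDeriv {n : ℕ} {B : Set (ST n)} {G : ST n → ℝ} (h : IsTest B G) (e : ST n) :
    IsTest B (dirDeriv e G) where
  smooth := (h.smooth.fderiv_right (m := ∞) (by simp)).clm_apply contDiff_const
  supp := (tsupport_fderiv_apply_subset ℝ e).trans h.supp

lemma IsTest.mul_left {n : ℕ} {B : Set (ST n)} {G : ST n → ℝ} (h : IsTest B G) {c : ST n → ℝ}
    (hc : ContDiff ℝ ∞ c) : IsTest B (fun y => c y * G y) where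
  smooth := hc.mul h.smooth
  supp := (tsupport_mul_subset_right (f := c) (g := G)).trans h.supp

/-- The test function `G`, transported to the scale `s` around the point `z` and normalized so
that its integral does not depend on `s` and `z`. -/
def kern {n : ℕ} (G : ST n → ℝ) (s : ℝ) (z : ST n) (y : ST n) : ℝ :=
  s⁻¹ ^ (n + 2) * G (dil s⁻¹ (y - z))

lemma contDiff_kern {n : ℕ} {G : ST n → ℝ} (hG : ContDiff ℝ ∞ G) (s : ℝ) (z : ST n) :
    ContDiff ℝ ∞ (kern G s z) := by
  unfold kern
  exact contDiff_const.mul (hG.comp ((dil s⁻¹).contDiff.comp (contDiff_id.sub contDiff_const)))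

lemma dirDeriv_kern {n : ℕ} {G : ST n → ℝ} (hG : ContDiff ℝ ∞ G) (s : ℝ) (z e : ST n) :
    dirDeriv e (kern G s z) = kern (dirDeriv (dil s⁻¹ e) G) s z := by
  ext y
  have h1 : HasFDerivAt (fun y : ST n => dil s⁻¹ (y - z)) (dil s⁻¹) y := by
    exact (dil s⁻¹).hasFDerivAt.comp y ((hasFDerivAt_id y).sub_const z)
  have h2 := ((hG.differentiable (by simp) (dil s⁻¹ (y - z))).hasFDerivAt.comp y h1).const_mul
    (s⁻¹ ^ (n + 2))
  have h3 : HasFDerivAt (kern G s z) _ y := h2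
  simp [dirDeriv, h3.fderiv, kern]

lemma dirDeriv_smul {n : ℕ} (c : ℝ) (e : ST n) (G : ST n → ℝ) (y : ST n) :
    dirDeriv (c • e) G y = c * dirDeriv e G y := by simp [dirDeriv]

lemma dil_ex {n : ℕ} (s : ℝ) (i : Fin n) : dil s (ex i : ST n) = s • ex i := by
  simp [dil_apply, ex]

lemma dil_et {n : ℕ} (s : ℝ) : dil s (et : ST n) = s ^ 2 • et := by
  simp [dil_apply, et]

lemma eq_sum_smul_ex_add {n : ℕ} (z : ST n) : z = (∑ i, z.1 i • ex i) + z.2 • et := by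
  ext1
  · ext j
    simp [ex, et, Prod.fst_sum]
    rw [Finset.sum_eq_single j] <;> simp +contextual [eq_comm]
  · simp [ex, et, Prod.snd_sum]

lemma dirDeriv_eq_sum {n : ℕ} (G : ST n → ℝ) (y v : ST n) :
    dirDeriv v G y = (∑ i, v.1 i * dirDeriv (ex i) G y) + v.2 * dirDeriv et G y := by
  conv_lhs => rw [eq_sum_smul_ex_add v]
  simp [dirDeriv, map_sum]

/-- The generator of the dilations, acting on densities:
`L G = ∑ ∂ᵢ(yᵢ G) + 2 ∂ₜ(t G) = (n + 2) G + y · ∇G + 2 t ∂ₜG`. -/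
def dilGen {n : ℕ} (G : ST n → ℝ) (y : ST n) : ℝ :=
  (∑ i, dirDeriv (ex i) (fun ζ => ζ.1 i * G ζ) y) + 2 * dirDeriv et (fun ζ => ζ.2 * G ζ) y

lemma contDiff_coord {n : ℕ} (i : Fin n) : ContDiff ℝ ∞ (fun ζ : ST n => ζ.1 i) := by
  fun_prop

lemma dilGen_eq {n : ℕ} {G : ST n → ℝ} (hG : ContDiff ℝ ∞ G) (y : ST n) :
    dilGen G y = (n + 2) * G y + fderiv ℝ G y (y.1, 2 * y.2) := by
  have hd := (hG.differentiable (by simp) y).hasFDerivAt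
  have h1 : ∀ i, dirDeriv (ex i) (fun ζ => ζ.1 i * G ζ) y
      = G y + y.1 i * dirDeriv (ex i) G y := by
    intro i
    have hc : HasFDerivAt (fun ζ : ST n => ζ.1 i)
        ((EuclideanSpace.proj i).comp (ContinuousLinearMap.fst ℝ (E n) ℝ)) y :=
      ((EuclideanSpace.proj i).comp (ContinuousLinearMap.fst ℝ (E n) ℝ)).hasFDerivAt
    have h : fderiv ℝ (fun ζ : ST n => ζ.1 i * G ζ) y = _ := (hc.mul hd).fderiv
    simp only [dirDeriv]
    rw [h]
    simp [ex]
    ring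
  have h2 : dirDeriv et (fun ζ : ST n => ζ.2 * G ζ) y = G y + y.2 * dirDeriv et G y := by
    have hc : HasFDerivAt (fun ζ : ST n => ζ.2) (ContinuousLinearMap.snd ℝ (E n) ℝ) y :=
      (ContinuousLinearMap.snd ℝ (E n) ℝ).hasFDerivAt
    have h : fderiv ℝ (fun ζ : ST n => ζ.2 * G ζ) y = _ := (hc.mul hd).fderiv
    simp only [dirDeriv]
    rw [h]
    simp [et]
    ring
  have h3 := dirDeriv_eq_sum G y (y.1, 2 * y.2)
  have h4 : fderiv ℝ G y (y.1, 2 * y.2) = dirDeriv (y.1, 2 * y.2) G y := rfl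
  rw [h4, h3, dilGen, h2, Finset.sum_congr rfl (fun i _ => h1 i), Finset.sum_add_distrib]
  simp
  ring

lemma IsTest.dilGen {n : ℕ} {b : ST n} {δ : ℝ} {G : ST n → ℝ} (h : IsTest (Metric.ball b δ) G) :
    Continuous (dilGen G) ∧ HasCompactSupport (dilGen G) := by
  have h1 : ∀ i, IsTest (Metric.ball b δ)
      (ParabolicPoincare.dirDeriv (ex i) (fun ζ => ζ.1 i * G ζ)) := fun i =>
    (h.mul_left (contDiff_coord i)).dirDeriv _
  have h2 : IsTest (Metric.ball b δ)
      (ParabolicPoincare.dirDeriv et (fun ζ => ζ.2 * G ζ)) :=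
    (h.mul_left contDiff_snd).dirDeriv _
  refine ⟨?_, ?_⟩
  · exact (continuous_finsetSum _ fun i _ => (h1 i).smooth.continuous).add
      (continuous_const.mul h2.smooth.continuous)
  · refine HasCompactSupport.intro (isCompact_closedBall b δ) fun y hy => ?_
    have h0 : ∀ {F : ST n → ℝ}, IsTest (Metric.ball b δ) F → F y = 0 := fun hF =>
      image_eq_zero_of_notMem_tsupport fun hy' => hy (Metric.ball_subset_closedBall (hF.supp hy'))
    simp [ParabolicPoincare.dilGen, h0 h2, fun i => h0 (h1 i)]

lemma hasDerivAt_kern {n : ℕ} {G : ST n → ℝ} (hG : ContDiff ℝ ∞ G) {s : ℝ} (hs : 0 < s)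
    (z y : ST n) :
    HasDerivAt (fun s => kern G s z y) (-s⁻¹ * kern (dilGen G) s z y) s := by
  have hi := hasDerivAt_inv hs.ne'
  set v := y - z with hv
  have h1 : HasDerivAt (fun s : ℝ => dil s⁻¹ v)
      ((-(s ^ 2)⁻¹) • v.1, ((2 : ℕ) * s⁻¹ ^ (2 - 1) * -(s ^ 2)⁻¹) * v.2) s :=
    (hi.smul_const v.1).prodMk ((hi.pow 2).mul_const v.2)
  have h2 := (hG.differentiable (by simp) (dil s⁻¹ v)).hasFDerivAt.comp_hasDerivAt s h1
  have h3 := (hi.pow (n + 2)).mul h2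
  refine h3.congr_deriv ?_
  have hw : (((-(s ^ 2)⁻¹) • v.1, ((2 : ℕ) * s⁻¹ ^ (2 - 1) * -(s ^ 2)⁻¹) * v.2) : ST n)
      = (-s⁻¹) • ((dil s⁻¹ v).1, 2 * (dil s⁻¹ v).2) := by
    simp only [dil_apply, Prod.smul_mk, smul_smul, smul_eq_mul]
    refine Prod.ext ?_ ?_
    · dsimp only
      congr 1
      field_simp
    · push_cast
      field_simp
  rw [hw, map_smul]
  simp only [kern, dilGen_eq hG, ← hv, Function.comp, smul_eq_mul, Pi.pow_apply]
  push_cast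
  simp only [← inv_pow]
  ring

/-! ### Pairing with rescaled test functions -/

/-- The average of `w` over `Q` at scale `s` around `z`, with profile `G`. -/
def pairing {n : ℕ} (Q : Set (ST n)) (w G : ST n → ℝ) (s : ℝ) (z : ST n) : ℝ :=
  ∫ y in Q, w y * kern G s z y

lemma exists_bound {n : ℕ} {G : ST n → ℝ} (hc : Continuous G) (hs : HasCompactSupport G) :
    ∃ M, 0 ≤ M ∧ ∀ y, |G y| ≤ M := by
  obtain ⟨M, hM⟩ := hc.bounded_above_of_compact_support hs
  exact ⟨M, (norm_nonneg _).trans (hM 0), hM⟩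

lemma continuous_kern {n : ℕ} {G : ST n → ℝ} (hG : Continuous G) (s : ℝ) (z : ST n) :
    Continuous (kern G s z) := by
  unfold kern
  fun_prop

lemma abs_kern_le {n : ℕ} {G : ST n → ℝ} {M : ℝ} (hM : ∀ y, |G y| ≤ M) {s : ℝ} (hs : 0 < s)
    (z y : ST n) : |kern G s z y| ≤ s⁻¹ ^ (n + 2) * M := by
  rw [kern, abs_mul, abs_of_nonneg (by positivity)]
  exact mul_le_mul_of_nonneg_left (hM _) (by positivity)

lemma integrable_mul_kern {n : ℕ} {Q : Set (ST n)} {w G : ST n → ℝ} (hw : IntegrableOn w Q)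
    (hc : Continuous G) (hk : HasCompactSupport G) {s : ℝ} (hs : 0 < s) (z : ST n) :
    IntegrableOn (fun y => w y * kern G s z y) Q := by
  obtain ⟨M, -, hM⟩ := exists_bound hc hk
  exact hw.mul_bdd (c := s⁻¹ ^ (n + 2) * M)
    (continuous_kern hc s z).aestronglyMeasurable
    (Eventually.of_forall fun y => abs_kern_le hM hs z y)

lemma hasDerivAt_pairing_scale {n : ℕ} {Q : Set (ST n)} {w G : ST n → ℝ} {b : ST n} {δ : ℝ}
    (hw : IntegrableOn w Q) (hG : IsTest (Metric.ball b δ) G) {s : ℝ} (hs : 0 < s) (z : ST n) :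
    HasDerivAt (fun s => pairing Q w G s z) (-s⁻¹ * pairing Q w (dilGen G) s z) s := by
  obtain ⟨M, hM0, hM⟩ := exists_bound hG.dilGen.1 hG.dilGen.2
  have hnhds : Ioi (s / 2) ∈ 𝓝 s := Ioi_mem_nhds (by linarith)
  have key := hasDerivAt_integral_of_dominated_loc_of_deriv_le (μ := volume.restrict Q)
    (F := fun r y => w y * kern G r z y)
    (F' := fun r y => w y * (-r⁻¹ * kern (dilGen G) r z y))
    (bound := fun y => |w y| * ((s / 2)⁻¹ * ((s / 2)⁻¹ ^ (n + 2) * M))) hnhds ?_ ?_ ?_ ?_ ?_ ?_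
  · refine key.2.congr_deriv ?_
    simp only [pairing]
    rw [← integral_const_mul]
    congr 1; ext y; ring
  · exact Eventually.of_forall fun r =>
      hw.1.mul (continuous_kern hG.smooth.continuous r z).aestronglyMeasurable
  · exact integrable_mul_kern hw hG.smooth.continuous hG.hasCompactSupport hs z
  · exact hw.1.mul (continuous_const.mul (continuous_kern hG.dilGen.1 s z)).aestronglyMeasurable
  · refine Eventually.of_forall fun y r hr => ?_
    have hr' : s / 2 < r := hr
    have hr0 : 0 < r := by linarith
    have hle : r⁻¹ ≤ (s / 2)⁻¹ := by gcongr
    have := abs_kern_le hM hr0 z y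
    rw [Real.norm_eq_abs, abs_mul, abs_mul, abs_neg, abs_of_pos (inv_pos.2 hr0)]
    gcongr
    exact this.trans (by gcongr)
  · exact hw.norm.mul_const _
  · refine Eventually.of_forall fun y r hr => ?_
    have hr' : s / 2 < r := hr
    exact (hasDerivAt_kern hG.smooth (by linarith) z y).const_mul (w y)

lemma hasDerivAt_pairing_translate {n : ℕ} {Q : Set (ST n)} {w G : ST n → ℝ} {b : ST n} {δ : ℝ}
    (hw : IntegrableOn w Q) (hG : IsTest (Metric.ball b δ) G) {s : ℝ} (hs : 0 < s) (z η : ST n)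
    (θ : ℝ) :
    HasDerivAt (fun θ : ℝ => pairing Q w G s (z + θ • dil s η))
      (-pairing Q w (dirDeriv η G) s (z + θ • dil s η)) θ := by
  have hG' := hG.dirDeriv η
  obtain ⟨M, hM0, hM⟩ := exists_bound hG'.smooth.continuous hG'.hasCompactSupport
  have key := hasDerivAt_integral_of_dominated_loc_of_deriv_le (μ := volume.restrict Q)
    (F := fun r y => w y * kern G s (z + r • dil s η) y)
    (F' := fun r y => w y * (- kern (dirDeriv η G) s (z + r • dil s η) y)) (x₀ := θ)
    (bound := fun y => |w y| * (s⁻¹ ^ (n + 2) * M)) univ_mem ?_ ?_ ?_ ?_ ?_ ?_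
  · refine key.2.congr_deriv ?_
    simp only [pairing]
    rw [← integral_neg]
    congr 1; ext y; ring
  · exact Eventually.of_forall fun r =>
      hw.1.mul (continuous_kern hG.smooth.continuous s _).aestronglyMeasurable
  · exact integrable_mul_kern hw hG.smooth.continuous hG.hasCompactSupport hs _
  · exact hw.1.mul (continuous_kern hG'.smooth.continuous s _).neg.aestronglyMeasurable
  · refine Eventually.of_forall fun y r _ => ?_
    rw [Real.norm_eq_abs, abs_mul, abs_neg]
    gcongr
    exact abs_kern_le hM hs _ y
  · exact hw.norm.mul_const _
  · refine Eventually.of_forall fun y r _ => ?_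
    have h1 : HasDerivAt (fun r : ℝ => dil s⁻¹ (y - (z + r • dil s η))) (-η) r := by
      have : HasDerivAt (fun r : ℝ => y - (z + r • dil s η)) (-(dil s η)) r := by
        simpa using (((hasDerivAt_id r).smul_const (dil s η)).const_add z).const_sub y
      have h := (dil s⁻¹).hasFDerivAt.comp_hasDerivAt r this
      rwa [map_neg, dil_inv_dil hs.ne'] at h
    have h2 := (hG.smooth.differentiable (by simp) _).hasFDerivAt.comp_hasDerivAt r h1
    refine ((h2.const_mul (s⁻¹ ^ (n + 2))).const_mul (w y)).congr_deriv ?_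
    simp [kern, dirDeriv]

/-! ### Averages of weak derivatives and of `L^p` functions -/

/-- The point `z` is admissible at the scale `s`: the sets `z + dil r (B(b,δ))` lie in `Q` for all
scales `r` between `s` and `h`. The averages at these scales then see `Q` only, and weak
derivatives can be moved to the profile. -/
structure Admissible {n : ℕ} (Q : Set (ST n)) (b : ST n) (δ h s : ℝ) (z : ST n) : Prop where
  pos : 0 < s
  le : s ≤ h
  mem : ∀ r, s ≤ r → r ≤ h → ∀ y ∈ Metric.ball b δ, z + dil r y ∈ Q

lemma Admissible.mono {n : ℕ} {Q : Set (ST n)} {b : ST n} {δ h s : ℝ} {z : ST n}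
    (H : Admissible Q b δ h s z) {r : ℝ} (hr : s ≤ r) (hr' : r ≤ h) : Admissible Q b δ h r z :=
  ⟨H.pos.trans_le hr, hr', fun r' h1 h2 => H.mem r' (hr.trans h1) h2⟩

lemma Admissible.isTest_kern {n : ℕ} {Q : Set (ST n)} {b : ST n} {δ h s : ℝ} {z : ST n}
    (H : Admissible Q b δ h s z) {G : ST n → ℝ} (hG : IsTest (Metric.ball b δ) G) :
    IsTest Q (kern G s z) where
  smooth := contDiff_kern hG.smooth s z
  supp := by
    intro y hy
    have hc : Continuous fun y : ST n => dil s⁻¹ (y - z) := by fun_prop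
    have h1 : y ∈ tsupport (G ∘ fun y : ST n => dil s⁻¹ (y - z)) := tsupport_mul_subset_right hy
    have h2 := H.mem s le_rfl H.le _ (hG.supp (tsupport_comp_subset_preimage G hc h1))
    rwa [dil_dil_inv H.pos.ne', add_sub_cancel] at h2

lemma pairing_const_mul {n : ℕ} (Q : Set (ST n)) (w G : ST n → ℝ) (c s : ℝ) (z : ST n) :
    pairing Q w (fun y => c * G y) s z = c * pairing Q w G s z := by
  simp only [pairing]
  rw [← integral_const_mul]
  congr 1; ext y; simp only [kern]; ring

lemma IsWeakDeriv.pairing_dirDeriv {n : ℕ} {Q : Set (ST n)} {e : ST n} {u v : ST n → ℝ}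
    (hQ : Bornology.IsBounded Q) (huv : IsWeakDeriv Q e u v) {b : ST n} {δ h s : ℝ} {z : ST n}
    (H : Admissible Q b δ h s z) {G : ST n → ℝ} (hG : IsTest (Metric.ball b δ) G) :
    pairing Q u (dirDeriv (dil s⁻¹ e) G) s z = - pairing Q v G s z := by
  have ht := H.isTest_kern hG
  have := huv.integral_eq _ ht.smooth
    (Metric.isCompact_of_isClosed_isBounded (isClosed_tsupport _) (hQ.subset ht.supp)) ht.supp
  rwa [dirDeriv_kern hG.smooth] at this

lemma IsWeakDeriv.pairing_ex {n : ℕ} {Q : Set (ST n)} {i : Fin n} {u v : ST n → ℝ}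
    (hQ : Bornology.IsBounded Q) (huv : IsWeakDeriv Q (ex i) u v) {b : ST n} {δ h s : ℝ} {z : ST n}
    (H : Admissible Q b δ h s z) {G : ST n → ℝ} (hG : IsTest (Metric.ball b δ) G) :
    pairing Q u (dirDeriv (ex i) G) s z = - (s * pairing Q v G s z) := by
  have h1 := huv.pairing_dirDeriv hQ H hG
  rw [dil_ex, funext (dirDeriv_smul _ _ _), pairing_const_mul] at h1
  rw [← mul_neg, ← h1, mul_inv_cancel_left₀ H.pos.ne']

lemma IsWeakDeriv.pairing_et {n : ℕ} {Q : Set (ST n)} {u v : ST n → ℝ}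
    (hQ : Bornology.IsBounded Q) (huv : IsWeakDeriv Q et u v) {b : ST n} {δ h s : ℝ} {z : ST n}
    (H : Admissible Q b δ h s z) {G : ST n → ℝ} (hG : IsTest (Metric.ball b δ) G) :
    pairing Q u (dirDeriv et G) s z = - (s ^ 2 * pairing Q v G s z) := by
  have h1 := huv.pairing_dirDeriv hQ H hG
  rw [dil_et, funext (dirDeriv_smul _ _ _), pairing_const_mul] at h1
  rw [← mul_neg, ← h1, inv_pow, mul_inv_cancel_left₀ (pow_ne_zero 2 H.pos.ne')]

lemma abs_pairing_le {n : ℕ} {Q : Set (ST n)} {w G : ST n → ℝ} {M : ℝ} (hM : ∀ y, |G y| ≤ M)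
    (hw : IntegrableOn w Q) {s : ℝ} (hs : 0 < s) (z : ST n) :
    |pairing Q w G s z| ≤ (∫ y in Q, |w y|) * (s⁻¹ ^ (n + 2) * M) := by
  rw [← integral_mul_const, ← Real.norm_eq_abs]
  refine norm_integral_le_of_norm_le (hw.norm.mul_const _) (Eventually.of_forall fun y => ?_)
  rw [Real.norm_eq_abs, abs_mul]
  gcongr
  exact abs_kern_le hM hs z y

lemma volume_parabolic_box {n : ℕ} (z : ST n) {s R : ℝ} (hs : 0 < s) (hR : 0 ≤ R) :
    volume (Metric.closedBall z.1 (s * R) ×ˢ Metric.closedBall z.2 (s ^ 2 * R) : Set (ST n))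
      = ENNReal.ofReal (s ^ (n + 2)) *
        (ENNReal.ofReal (R ^ n) * volume (Metric.ball (0 : E n) 1) * ENNReal.ofReal (2 * R)) := by
  rw [Measure.volume_eq_prod, Measure.prod_prod, Real.volume_closedBall,
    Measure.addHaar_closedBall _ _ (by positivity), finrank_euclideanSpace_fin,
    mul_pow, ENNReal.ofReal_mul (by positivity), pow_add, ENNReal.ofReal_mul (by positivity),
    ENNReal.ofReal_mul (by positivity), ENNReal.ofReal_mul (by positivity),
    ENNReal.ofReal_mul (by positivity)]
  ring

lemma exists_abs_pairing_le_of_memLp {n : ℕ} {Q : Set (ST n)} {w G : ST n → ℝ} {p : ℝ}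
    (hp : 1 ≤ p) (hw : MemLp w (ENNReal.ofReal p) (volume.restrict Q)) {b : ST n} {δ : ℝ}
    (hG : IsTest (Metric.ball b δ) G) :
    ∃ C, 0 ≤ C ∧ ∀ s z, 0 < s → |pairing Q w G s z| ≤ C * s ^ (-((n : ℝ) + 2) / p) := by
  obtain ⟨M, hM0, hM⟩ := exists_bound hG.smooth.continuous hG.hasCompactSupport
  have hp0 : 0 < p := by linarith
  set q : ℝ := 1 - 1 / p with hq
  have hq0 : 0 ≤ q := by
    rw [hq, sub_nonneg, div_le_one hp0]; exact hp
  set R : ℝ := ‖b‖ + |δ| with hR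
  have hR0 : 0 ≤ R := by positivity
  set V : ℝ≥0∞ := ENNReal.ofReal (R ^ n) * volume (Metric.ball (0 : E n) 1) *
    ENNReal.ofReal (2 * R) with hV
  have hVtop : V ≠ ⊤ := ENNReal.mul_ne_top
    (ENNReal.mul_ne_top ENNReal.ofReal_ne_top measure_ball_lt_top.ne) ENNReal.ofReal_ne_top
  set μ := volume.restrict Q with hμ
  set A := eLpNorm w (ENNReal.ofReal p) μ with hA
  have hAtop : A ≠ ⊤ := hw.2.ne
  refine ⟨M * (A.toReal * V.toReal ^ q), by positivity, fun s z hs => ?_⟩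
  set box : Set (ST n) := Metric.closedBall z.1 (s * R) ×ˢ Metric.closedBall z.2 (s ^ 2 * R)
    with hbox
  have hboxm : MeasurableSet box :=
    Metric.isClosed_closedBall.measurableSet.prod Metric.isClosed_closedBall.measurableSet
  set K : ℝ := s⁻¹ ^ (n + 2) * M with hK
  have hK0 : 0 ≤ K := by positivity
  -- the rescaled profile lives in a parabolic box of size `s`
  have hker : ∀ y, y ∉ box → kern G s z y = 0 := by
    intro y hy
    by_contra hne
    have h1 : G (dil s⁻¹ (y - z)) ≠ 0 := fun h0 => hne (by rw [kern, h0, mul_zero])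
    have h2 := hG.supp (subset_tsupport G h1)
    have h3 : ‖dil s⁻¹ (y - z)‖ ≤ R := by
      have h4 : ‖dil s⁻¹ (y - z) - b‖ < δ := by simpa [dist_eq_norm] using h2
      calc ‖dil s⁻¹ (y - z)‖ = ‖b + (dil s⁻¹ (y - z) - b)‖ := by congr 1; abel
        _ ≤ ‖b‖ + ‖dil s⁻¹ (y - z) - b‖ := norm_add_le _ _
        _ ≤ R := by rw [hR]; gcongr; exact h4.le.trans (le_abs_self δ)
    rw [dil_apply, Prod.norm_mk, max_le_iff, norm_smul, norm_mul, Prod.fst_sub, Prod.snd_sub,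
      norm_pow, Real.norm_of_nonneg (inv_pos.2 hs).le, inv_pow, inv_mul_le_iff₀ hs,
      inv_mul_le_iff₀ (by positivity)] at h3
    exact hy ⟨by simpa [dist_eq_norm] using h3.1, by simpa [dist_eq_norm] using h3.2⟩
  have h1 : ‖pairing Q w G s z‖ₑ
      ≤ (A * (ENNReal.ofReal (s ^ (n + 2)) * V) ^ q) * ENNReal.ofReal K := by
    calc ‖pairing Q w G s z‖ₑ ≤ ∫⁻ y, ‖w y * kern G s z y‖ₑ ∂μ :=
          enorm_integral_le_lintegral_enorm _
      _ ≤ ∫⁻ y, box.indicator (fun y => ‖w y‖ₑ * ENNReal.ofReal K) y ∂μ := by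
          refine lintegral_mono fun y => ?_
          by_cases hy : y ∈ box
          · rw [indicator_of_mem hy, enorm_mul]
            gcongr
            rw [Real.enorm_eq_ofReal_abs]
            exact ENNReal.ofReal_le_ofReal (abs_kern_le hM hs z y)
          · simp [hker y hy]
      _ = (∫⁻ y in box, ‖w y‖ₑ ∂μ) * ENNReal.ofReal K := by
          rw [lintegral_indicator hboxm, lintegral_mul_const' _ _ ENNReal.ofReal_ne_top]
      _ = eLpNorm w 1 (μ.restrict box) * ENNReal.ofReal K := by
          rw [eLpNorm_one_eq_lintegral_enorm]
      _ ≤ (A * (ENNReal.ofReal (s ^ (n + 2)) * V) ^ q) * ENNReal.ofReal K := by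
          gcongr
          refine (eLpNorm_le_eLpNorm_mul_rpow_measure_univ (q := ENNReal.ofReal p)
            (by simpa using hp) hw.1.restrict).trans ?_
          rw [ENNReal.toReal_one, ENNReal.toReal_ofReal hp0.le, div_one, ← hq]
          gcongr
          · exact eLpNorm_mono_measure _ Measure.restrict_le_self
          · rw [Measure.restrict_apply_univ, hV, ← volume_parabolic_box z hs hR0]
            exact Measure.restrict_apply_le _ _
  have h2 := ENNReal.toReal_mono (ENNReal.mul_ne_top (ENNReal.mul_ne_top hAtop
    (ENNReal.rpow_ne_top_of_nonneg hq0 (ENNReal.mul_ne_top ENNReal.ofReal_ne_top hVtop)))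
      ENNReal.ofReal_ne_top) h1
  rw [toReal_enorm, Real.norm_eq_abs, ENNReal.toReal_mul, ENNReal.toReal_mul,
    ← ENNReal.toReal_rpow, ENNReal.toReal_mul, ENNReal.toReal_ofReal (by positivity),
    ENNReal.toReal_ofReal hK0, Real.mul_rpow (by positivity) ENNReal.toReal_nonneg] at h2
  refine h2.trans (le_of_eq ?_)
  have h3 : ((s ^ (n + 2) : ℝ)) ^ q * s⁻¹ ^ (n + 2) = s ^ (-((n : ℝ) + 2) / p) := by
    rw [inv_pow, ← Real.rpow_natCast s (n + 2), ← Real.rpow_mul hs.le, ← Real.rpow_neg hs.le,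
      ← Real.rpow_add hs, hq]
    congr 1
    push_cast
    field_simp
    ring
  rw [← h3, hK]
  ring

/-! ### Growth of averages as the scale tends to zero -/

/-- The averages of `w` at the scale `s` are `O(s ^ γ)` at admissible points. -/
def Growth {n : ℕ} (Q : Set (ST n)) (b : ST n) (δ h : ℝ) (w : ST n → ℝ) (γ : ℝ) : Prop :=
  ∀ G, IsTest (Metric.ball b δ) G → ∃ C, 0 ≤ C ∧
    ∀ s z, Admissible Q b δ h s z → |pairing Q w G s z| ≤ C * s ^ γ

/-- The averages of `w` at the scale `s` whose profile is a derivative of a test function are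
`O(s ^ γ)` at admissible points. This is the smoothness of order `γ` of `w`. -/
def DerivGrowth {n : ℕ} (Q : Set (ST n)) (b : ST n) (δ h : ℝ) (w : ST n → ℝ) (γ : ℝ) : Prop :=
  ∀ G, IsTest (Metric.ball b δ) G → ∃ C, 0 ≤ C ∧
    ∀ s z, Admissible Q b δ h s z → ∀ η, |pairing Q w (dirDeriv η G) s z| ≤ C * ‖η‖ * s ^ γ

lemma abs_apply_le_norm {n : ℕ} (η : ST n) (i : Fin n) : |η.1 i| ≤ ‖η‖ :=
  (PiLp.norm_apply_le η.1 i).trans (norm_fst_le η)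

lemma pairing_sum_add {n : ℕ} {Q : Set (ST n)} {w : ST n → ℝ} {b : ST n} {δ : ℝ}
    (hw : IntegrableOn w Q) {F : Fin n → ST n → ℝ} {H : ST n → ℝ}
    (hF : ∀ i, IsTest (Metric.ball b δ) (F i)) (hH : IsTest (Metric.ball b δ) H)
    {s : ℝ} (hs : 0 < s) (z : ST n) (a : Fin n → ℝ) (c : ℝ) :
    pairing Q w (fun y => (∑ i, a i * F i y) + c * H y) s z
      = (∑ i, a i * pairing Q w (F i) s z) + c * pairing Q w H s z := by
  have hi : ∀ {G : ST n → ℝ}, IsTest (Metric.ball b δ) G →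
      IntegrableOn (fun y => w y * kern G s z y) Q := fun hG =>
    integrable_mul_kern hw hG.smooth.continuous hG.hasCompactSupport hs z
  simp only [pairing]
  simp_rw [← integral_const_mul]
  rw [← integral_finsetSum _ fun i _ => (hi (hF i)).const_mul _, ← integral_add
    (integrable_finsetSum _ fun i _ => (hi (hF i)).const_mul _) ((hi hH).const_mul _)]
  congr 1; ext y
  simp only [kern, mul_add, Finset.mul_sum]
  congr 1
  · exact Finset.sum_congr rfl fun i _ => by ring
  · ring

lemma derivGrowth_of_coord {n : ℕ} {Q : Set (ST n)} {b : ST n} {δ h : ℝ} {w : ST n → ℝ} {γ : ℝ}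
    (hw : IntegrableOn w Q)
    (hx : ∀ i G, IsTest (Metric.ball b δ) G → ∃ C, 0 ≤ C ∧
      ∀ s z, Admissible Q b δ h s z → |pairing Q w (dirDeriv (ex i) G) s z| ≤ C * s ^ γ)
    (ht : ∀ G, IsTest (Metric.ball b δ) G → ∃ C, 0 ≤ C ∧
      ∀ s z, Admissible Q b δ h s z → |pairing Q w (dirDeriv et G) s z| ≤ C * s ^ γ) :
    DerivGrowth Q b δ h w γ := by
  intro G hG
  choose C hC0 hC using fun i => hx i G hG
  obtain ⟨D, hD0, hD⟩ := ht G hG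
  refine ⟨(∑ i, C i) + D, add_nonneg (Finset.sum_nonneg fun i _ => hC0 i) hD0,
    fun s z H η => ?_⟩
  rw [funext fun y => dirDeriv_eq_sum G y η,
    pairing_sum_add hw (fun i => hG.dirDeriv (ex i)) (hG.dirDeriv et) H.pos z η.1 η.2]
  have hs : 0 ≤ s ^ γ := Real.rpow_nonneg H.pos.le _
  calc _ ≤ (∑ i, |η.1 i * pairing Q w (dirDeriv (ex i) G) s z|)
        + |η.2 * pairing Q w (dirDeriv et G) s z| :=
        (abs_add_le _ _).trans (add_le_add_left (Finset.abs_sum_le_sum_abs _ _) _)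
    _ ≤ (∑ i, ‖η‖ * (C i * s ^ γ)) + ‖η‖ * (D * s ^ γ) := by
        simp only [abs_mul]
        gcongr with i
        · exact abs_apply_le_norm η i
        · exact hC i s z H
        · exact norm_snd_le η
        · exact hD s z H
    _ = _ := by
        rw [← Finset.mul_sum, ← Finset.sum_mul]; ring

lemma DerivGrowth.dilGen {n : ℕ} {Q : Set (ST n)} {b : ST n} {δ h : ℝ} {w : ST n → ℝ} {γ : ℝ}
    (hw : IntegrableOn w Q) (hg : DerivGrowth Q b δ h w γ) {G : ST n → ℝ}
    (hG : IsTest (Metric.ball b δ) G) :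
    ∃ C, 0 ≤ C ∧ ∀ s z, Admissible Q b δ h s z → |pairing Q w (dilGen G) s z| ≤ C * s ^ γ := by
  have hx : ∀ i, IsTest (Metric.ball b δ) fun ζ => ζ.1 i * G ζ := fun i =>
    hG.mul_left (contDiff_coord i)
  have ht : IsTest (Metric.ball b δ) fun ζ => ζ.2 * G ζ := hG.mul_left contDiff_snd
  choose C hC0 hC using fun i => hg _ (hx i)
  obtain ⟨D, hD0, hD⟩ := hg _ ht
  refine ⟨(∑ i, C i * ‖(ex i : ST n)‖) + 2 * (D * ‖(et : ST n)‖),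
    add_nonneg (Finset.sum_nonneg fun i _ => mul_nonneg (hC0 i) (norm_nonneg _)) (by positivity),
    fun s z H => ?_⟩
  have h1 := pairing_sum_add hw (fun i => (hx i).dirDeriv (ex i)) (ht.dirDeriv et) H.pos z
    (fun _ => 1) 2
  simp only [one_mul] at h1
  have h2 : pairing Q w (ParabolicPoincare.dilGen G) s z = _ := h1
  rw [h2, add_mul, Finset.sum_mul, mul_assoc]
  refine (abs_add_le _ _).trans (add_le_add ((Finset.abs_sum_le_sum_abs _ _).trans
    (Finset.sum_le_sum fun i _ => hC i s z H _)) ?_)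
  rw [abs_mul, abs_two]
  gcongr
  exact hD s z H _

lemma abs_sub_le_of_hasDerivAt_rpow {f f' : ℝ → ℝ} {C γ s r : ℝ} (hγ : γ ≠ 0) (hs : 0 < s)
    (hsr : s ≤ r) (hf : ∀ x ∈ Icc s r, HasDerivAt f (f' x) x)
    (hb : ∀ x ∈ Icc s r, |f' x| ≤ x⁻¹ * (C * x ^ γ)) :
    |f r - f s| ≤ C * ((r ^ γ - s ^ γ) / γ) := by
  have hg : ∀ x ∈ Icc s r, HasDerivAt (fun x => C * (x ^ γ / γ)) (x⁻¹ * (C * x ^ γ)) x := by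
    intro x hx
    have hx0 : x ≠ 0 := (hs.trans_le hx.1).ne'
    refine (((Real.hasDerivAt_rpow_const (Or.inl hx0)).div_const γ).const_mul C).congr_deriv ?_
    rw [Real.rpow_sub_one hx0]
    field_simp
  have mono : ∀ σ : ℝ, |σ| = 1 →
      (C * (s ^ γ / γ)) - σ * f s ≤ C * (r ^ γ / γ) - σ * f r := by
    intro σ hσ
    have hd : ∀ x ∈ Icc s r, HasDerivAt (fun x => C * (x ^ γ / γ) - σ * f x)
        (x⁻¹ * (C * x ^ γ) - σ * f' x) x := fun x hx => (hg x hx).sub ((hf x hx).const_mul σ)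
    refine monotoneOn_of_deriv_nonneg (convex_Icc s r)
      (fun x hx => (hd x hx).continuousAt.continuousWithinAt)
      (fun x hx => (hd x (interior_subset hx)).differentiableAt.differentiableWithinAt)
      (fun x hx => ?_) (left_mem_Icc.2 hsr) (right_mem_Icc.2 hsr) hsr
    rw [(hd x (interior_subset hx)).deriv, sub_nonneg]
    refine (le_abs_self _).trans ?_
    rw [abs_mul, hσ, one_mul]
    exact hb x (interior_subset hx)
  have h1 := mono 1 (by simp)
  have h2 := mono (-1) (by simp)
  rw [sub_div, mul_sub, abs_le]
  constructor <;> linarith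

lemma DerivGrowth.scale {n : ℕ} {Q : Set (ST n)} {b : ST n} {δ h : ℝ} {w : ST n → ℝ} {γ : ℝ}
    (hw : IntegrableOn w Q) (hg : DerivGrowth Q b δ h w γ) (hγ : γ ≠ 0) {G : ST n → ℝ}
    (hG : IsTest (Metric.ball b δ) G) :
    ∃ C, 0 ≤ C ∧ ∀ s r z, Admissible Q b δ h s z → s ≤ r → r ≤ h →
      |pairing Q w G r z - pairing Q w G s z| ≤ C * ((r ^ γ - s ^ γ) / γ) := by
  obtain ⟨C, hC0, hC⟩ := hg.dilGen hw hG
  refine ⟨C, hC0, fun s r z H hsr hrh => ?_⟩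
  refine abs_sub_le_of_hasDerivAt_rpow hγ H.pos hsr
    (fun x hx => hasDerivAt_pairing_scale hw hG (H.pos.trans_le hx.1) z) fun x hx => ?_
  have hx0 : 0 < x := H.pos.trans_le hx.1
  rw [abs_mul, abs_neg, abs_of_pos (inv_pos.2 hx0)]
  gcongr
  exact hC x z (H.mono hx.1 (hx.2.trans hrh))

/-- For negative orders, the growth of all averages follows from that of the averages with a
derivative as profile, by integrating from the scale `h` down to the scale `s`. -/
lemma DerivGrowth.growth {n : ℕ} {Q : Set (ST n)} {b : ST n} {δ h : ℝ} {w : ST n → ℝ} {γ : ℝ}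
    (hw : IntegrableOn w Q) (hg : DerivGrowth Q b δ h w γ) (hγ : γ < 0) :
    Growth Q b δ h w γ := by
  intro G hG
  obtain ⟨C, hC0, hC⟩ := hg.scale hw hγ.ne hG
  obtain ⟨M, hM0, hM⟩ := exists_bound hG.smooth.continuous hG.hasCompactSupport
  have hI : 0 ≤ ∫ y in Q, |w y| := integral_nonneg fun _ => abs_nonneg _
  by_cases hh : 0 < h
  swap
  · exact ⟨0, le_rfl, fun s z H => absurd (H.pos.trans_le H.le) hh⟩
  refine ⟨(∫ y in Q, |w y|) * (h⁻¹ ^ (n + 2) * M) * (h ^ γ)⁻¹ + C * (-γ)⁻¹,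
    by have := neg_pos.2 hγ; positivity, fun s z H => ?_⟩
  have h1 := hC s h z H H.le le_rfl
  have h2 := abs_pairing_le hM hw hh z
  have hhγ : 0 < h ^ γ := Real.rpow_pos_of_pos hh _
  have h3 : h ^ γ ≤ s ^ γ := Real.rpow_le_rpow_of_nonpos H.pos H.le hγ.le
  have h4 : (h ^ γ - s ^ γ) / γ ≤ (-γ)⁻¹ * s ^ γ := by
    rw [← neg_div_neg_eq, div_eq_inv_mul]
    have := neg_pos.2 hγ
    gcongr
    linarith
  have h5 : 1 ≤ (h ^ γ)⁻¹ * s ^ γ := by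
    rwa [le_inv_mul_iff₀ hhγ, mul_one]
  have h6 : (∫ y in Q, |w y|) * (h⁻¹ ^ (n + 2) * M) ≤
      (∫ y in Q, |w y|) * (h⁻¹ ^ (n + 2) * M) * ((h ^ γ)⁻¹ * s ^ γ) :=
    le_mul_of_one_le_right (by positivity) h5
  have h7 : C * ((h ^ γ - s ^ γ) / γ) ≤ C * ((-γ)⁻¹ * s ^ γ) := by gcongr
  rw [abs_le] at h1 h2 ⊢
  constructor <;> nlinarith

lemma IsWeakDeriv.growth_ex {n : ℕ} {Q : Set (ST n)} (hQ : Bornology.IsBounded Q) {i : Fin n}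
    {u v : ST n → ℝ} (huv : IsWeakDeriv Q (ex i) u v) {b : ST n} {δ h γ : ℝ}
    (hv : Growth Q b δ h v γ) (G : ST n → ℝ) (hG : IsTest (Metric.ball b δ) G) :
    ∃ C, 0 ≤ C ∧ ∀ s z, Admissible Q b δ h s z →
      |pairing Q u (dirDeriv (ex i) G) s z| ≤ C * s ^ (γ + 1) := by
  obtain ⟨C, hC0, hC⟩ := hv G hG
  refine ⟨C, hC0, fun s z H => ?_⟩
  rw [huv.pairing_ex hQ H hG, abs_neg, abs_mul, abs_of_pos H.pos, Real.rpow_add_one H.pos.ne']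
  have := mul_le_mul_of_nonneg_left (hC s z H) H.pos.le
  linarith

lemma IsWeakDeriv.growth_et {n : ℕ} {Q : Set (ST n)} (hQ : Bornology.IsBounded Q)
    {u v : ST n → ℝ} (huv : IsWeakDeriv Q et u v) {b : ST n} {δ h γ : ℝ}
    (hv : Growth Q b δ h v γ) (G : ST n → ℝ) (hG : IsTest (Metric.ball b δ) G) :
    ∃ C, 0 ≤ C ∧ ∀ s z, Admissible Q b δ h s z →
      |pairing Q u (dirDeriv et G) s z| ≤ C * s ^ (γ + 2) := by
  obtain ⟨C, hC0, hC⟩ := hv G hG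
  refine ⟨C, hC0, fun s z H => ?_⟩
  rw [huv.pairing_et hQ H hG, abs_neg, abs_mul, abs_of_pos (pow_pos H.pos 2),
    Real.rpow_add H.pos, Real.rpow_two]
  have := mul_le_mul_of_nonneg_left (hC s z H) (pow_pos H.pos 2).le
  linarith

/-- The time derivative of `D_i u` is `D_i` of `u_t`: after moving both derivatives to the profile,
only `u_t` is needed. -/
lemma growth_et_of_mixed {n : ℕ} {Q : Set (ST n)} (hQ : Bornology.IsBounded Q) {i : Fin n}
    {u v ut : ST n → ℝ} (huv : IsWeakDeriv Q (ex i) u v) (hut : IsWeakDeriv Q et u ut)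
    {b : ST n} {δ h γ : ℝ} (hg : Growth Q b δ h ut γ) (G : ST n → ℝ)
    (hG : IsTest (Metric.ball b δ) G) :
    ∃ C, 0 ≤ C ∧ ∀ s z, Admissible Q b δ h s z →
      |pairing Q v (dirDeriv et G) s z| ≤ C * s ^ (γ + 1) := by
  obtain ⟨C, hC0, hC⟩ := hg _ (hG.dirDeriv (ex i))
  refine ⟨C, hC0, fun s z H => ?_⟩
  have h1 := huv.pairing_ex hQ H (hG.dirDeriv et)
  have h2 := hut.pairing_et hQ H (hG.dirDeriv (ex i))
  have hcomm : dirDeriv (ex i) (dirDeriv et G) = dirDeriv et (dirDeriv (ex i) G) := by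
    ext y
    have hd : DifferentiableAt ℝ (fderiv ℝ G) y :=
      (hG.smooth.fderiv_right (m := ∞) (by simp)).differentiable (by simp) y
    have hs : IsSymmSndFDerivAt ℝ G y := (hG.smooth.contDiffAt).isSymmSndFDerivAt (by
      rw [minSmoothness_of_isRCLikeNormedField]; exact WithTop.coe_le_coe.2 le_top)
    have key : ∀ e e' : ST n, dirDeriv e (dirDeriv e' G) y = fderiv ℝ (fderiv ℝ G) y e e' := by
      intro e e'
      have h : fderiv ℝ (dirDeriv e' G) y = _ :=
        (hd.hasFDerivAt.clm_apply (hasFDerivAt_const e' y)).fderiv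
      rw [dirDeriv, h]
      simp
    rw [key, key, hs.eq]
  rw [hcomm, h2, neg_inj] at h1
  have h3 : pairing Q v (dirDeriv et G) s z = s * pairing Q ut (dirDeriv (ex i) G) s z := by
    have := H.pos.ne'
    refine mul_left_cancel₀ this ?_
    rw [← h1]; ring
  rw [h3, abs_mul, abs_of_pos H.pos, Real.rpow_add_one H.pos.ne']
  have := mul_le_mul_of_nonneg_left (hC s z H) H.pos.le
  linarith

lemma growth_of_memLp {n : ℕ} {Q : Set (ST n)} {w : ST n → ℝ} {p : ℝ} (hp : 1 ≤ p)
    (hw : MemLp w (ENNReal.ofReal p) (volume.restrict Q)) (b : ST n) (δ h : ℝ) {γ : ℝ}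
    (hγ : γ ≤ -((n : ℝ) + 2) / p) : Growth Q b δ h w γ := by
  intro G hG
  obtain ⟨C, hC0, hC⟩ := exists_abs_pairing_le_of_memLp hp hw hG
  set κ := -((n : ℝ) + 2) / p
  by_cases hh : 0 < h
  swap
  · exact ⟨0, le_rfl, fun s z H => absurd (H.pos.trans_le H.le) hh⟩
  refine ⟨C * h ^ (κ - γ), by positivity, fun s z H => (hC s z H.pos).trans ?_⟩
  rw [mul_assoc]
  gcongr
  calc s ^ κ = s ^ (κ - γ) * s ^ γ := by rw [← Real.rpow_add H.pos]; ring_nf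
    _ ≤ h ^ (κ - γ) * s ^ γ := by
      refine mul_le_mul_of_nonneg_right ?_ (Real.rpow_nonneg H.pos.le _)
      exact Real.rpow_le_rpow H.pos.le H.le (sub_nonneg.2 hγ)

/-! ### Hölder continuity of the limit of the averages -/

/-- The parabolic distance `|x - y| + |t - s|^{1/2}`. -/
def parDist {n : ℕ} (z z' : ST n) : ℝ := ‖z.1 - z'.1‖ + √|z.2 - z'.2|

lemma parDist_nonneg {n : ℕ} (z z' : ST n) : 0 ≤ parDist z z' := by
  unfold parDist; positivity

lemma eq_of_parDist_nonpos {n : ℕ} {z z' : ST n} (h : parDist z z' ≤ 0) : z = z' := by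
  have h1 := norm_nonneg (z.1 - z'.1)
  have h2 := Real.sqrt_nonneg |z.2 - z'.2|
  unfold parDist at h
  have h3 : ‖z.1 - z'.1‖ = 0 := by linarith
  have h4 : √|z.2 - z'.2| = 0 := by linarith
  rw [Real.sqrt_eq_zero (abs_nonneg _), abs_eq_zero] at h4
  exact Prod.ext (sub_eq_zero.1 (norm_eq_zero.1 h3)) (sub_eq_zero.1 h4)

lemma norm_dil_inv_sub_le {n : ℕ} {z z' : ST n} {δ s : ℝ} (hδ1 : δ ≤ 1) (hs : 0 < s)
    (h : parDist z z' = δ * s) : ‖dil s⁻¹ (z' - z)‖ ≤ δ := by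
  have h1 := norm_nonneg (z.1 - z'.1)
  have h2 := Real.sqrt_nonneg |z.2 - z'.2|
  unfold parDist at h
  have hδ : 0 ≤ δ := by
    by_contra hneg
    have : δ * s < 0 := mul_neg_of_neg_of_pos (not_le.1 hneg) hs
    linarith
  have h3 : ‖z.1 - z'.1‖ ≤ s * δ := by linarith
  have h4 : √|z.2 - z'.2| ≤ δ * s := by linarith
  rw [Real.sqrt_le_left (by positivity)] at h4
  have h5 : |z.2 - z'.2| ≤ s ^ 2 * δ := by
    have : (δ * s) ^ 2 ≤ s ^ 2 * δ := by
      have : δ * δ ≤ δ * 1 := by gcongr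
      nlinarith [sq_nonneg s]
    linarith
  rw [dil_apply, Prod.norm_mk, max_le_iff, norm_smul, norm_mul, Prod.fst_sub, Prod.snd_sub,
    norm_pow, Real.norm_of_nonneg (inv_pos.2 hs).le, inv_pow, inv_mul_le_iff₀ hs,
    inv_mul_le_iff₀ (by positivity), norm_sub_rev, norm_sub_rev z'.2]
  exact ⟨h3, h5⟩

lemma norm_dil_le {n : ℕ} {r : ℝ} (hr : 0 ≤ r) (hr1 : r ≤ 1) (z : ST n) : ‖dil r z‖ ≤ ‖z‖ := by
  rw [dil_apply, Prod.norm_mk, norm_smul, norm_mul, norm_pow, Real.norm_of_nonneg hr]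
  refine max_le ?_ ?_
  · exact (mul_le_of_le_one_left (norm_nonneg _) hr1).trans (norm_fst_le z)
  · exact (mul_le_of_le_one_left (norm_nonneg _) (pow_le_one₀ hr hr1)).trans (norm_snd_le z)

/-- If the sets `z + dil s (B(b, 2δ))` lie in `Q`, then the points at parabolic distance
comparable to `s` from `z` are admissible at the scale `s`. -/
lemma admissible_translate {n : ℕ} {Q : Set (ST n)} {b : ST n} {δ h : ℝ} {z : ST n}
    (hz : ∀ s, 0 < s → s ≤ h → ∀ y ∈ Metric.ball b (2 * δ), z + dil s y ∈ Q) {s : ℝ} (hs : 0 < s)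
    (hsh : s ≤ h) {η : ST n} (hη : ‖η‖ ≤ δ) {θ : ℝ} (hθ : θ ∈ Icc (0 : ℝ) 1) :
    Admissible Q b δ h s (z + θ • dil s η) := by
  refine ⟨hs, hsh, fun r hsr hrh y hy => ?_⟩
  have hr : 0 < r := hs.trans_le hsr
  have h1 : z + θ • dil s η + dil r y = z + dil r (y + θ • dil (r⁻¹ * s) η) := by
    rw [map_add, map_smul, dil_dil, mul_inv_cancel_left₀ hr.ne']
    abel
  rw [h1]
  refine hz r hr hrh _ ?_
  have h2 : ‖dil (r⁻¹ * s) η‖ ≤ ‖η‖ :=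
    norm_dil_le (by positivity) ((inv_mul_le_one₀ hr).2 hsr) η
  have h3 : ‖θ • dil (r⁻¹ * s) η‖ ≤ δ := by
    rw [norm_smul, Real.norm_of_nonneg hθ.1]
    exact (mul_le_of_le_one_left (norm_nonneg _) hθ.2).trans (h2.trans hη)
  rw [Metric.mem_ball, dist_eq_norm] at hy ⊢
  calc ‖y + θ • dil (r⁻¹ * s) η - b‖ = ‖(y - b) + θ • dil (r⁻¹ * s) η‖ := by congr 1; abel
    _ ≤ ‖y - b‖ + ‖θ • dil (r⁻¹ * s) η‖ := norm_add_le _ _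
    _ < 2 * δ := by linarith

/-- Smoothness of positive order `γ` makes the averages converge at the rate `s ^ γ`, and the limit
is Hölder continuous: two points at distance comparable to `s` have averages at the scale `s` that
differ by `O(s ^ γ)`. -/
theorem DerivGrowth.exists_limit {n : ℕ} {Q : Set (ST n)} {b : ST n} {δ h : ℝ} {w : ST n → ℝ}
    {γ : ℝ} (hw : IntegrableOn w Q) (hg : DerivGrowth Q b δ h w γ) (hγ : 0 < γ) (hδ : 0 < δ)
    (hδ1 : δ ≤ 1) (hh : 0 < h) {D : Set (ST n)}
    (hD : ∀ z ∈ D, ∀ s, 0 < s → s ≤ h → ∀ y ∈ Metric.ball b (2 * δ), z + dil s y ∈ Q)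
    {G : ST n → ℝ} (hG : IsTest (Metric.ball b δ) G) :
    ∃ (v : ST n → ℝ) (C : ℝ), (∀ z ∈ D, |v z| ≤ C) ∧
      (∀ z ∈ D, ∀ z' ∈ D, |v z - v z'| ≤ C * parDist z z' ^ γ) ∧
      ∀ z ∈ D, ∀ s, 0 < s → s ≤ h → |pairing Q w G s z - v z| ≤ C * s ^ γ := by
  obtain ⟨C₀, hC₀, hscale⟩ := hg.scale hw hγ.ne' hG
  obtain ⟨C₂, hC₂, htrans⟩ := hg G hG
  obtain ⟨M, hM0, hM⟩ := exists_bound hG.smooth.continuous hG.hasCompactSupport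
  have hadm : ∀ z ∈ D, ∀ s, 0 < s → s ≤ h → Admissible Q b δ h s z := by
    intro z hz s hs hsh
    have := admissible_translate (hD z hz) hs hsh (η := 0) (by simpa using hδ.le)
      (left_mem_Icc.2 zero_le_one)
    simpa using this
  set C₁ := C₀ / γ with hC₁
  have hC₁0 : 0 ≤ C₁ := by positivity
  have hcauchy : ∀ z ∈ D, ∀ s r, 0 < s → s ≤ r → r ≤ h →
      |pairing Q w G r z - pairing Q w G s z| ≤ C₁ * r ^ γ := by
    intro z hz s r hs hsr hrh
    refine (hscale s r z (hadm z hz s hs (hsr.trans hrh)) hsr hrh).trans ?_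
    rw [hC₁, mul_div_assoc', div_mul_eq_mul_div]
    gcongr
    linarith [Real.rpow_nonneg hs.le γ]
  -- the limit along the scales `h / (k + 1)`
  set σ : ℕ → ℝ := fun k => h * (1 / ((k : ℝ) + 1)) with hσ
  have hσpos : ∀ k, 0 < σ k := fun k => by positivity
  have hσanti : ∀ k m, k ≤ m → σ m ≤ σ k := fun k m hkm => by
    simp only [hσ]; gcongr
  have hσh : ∀ k, σ k ≤ h := fun k => by
    have := hσanti 0 k (Nat.zero_le k)
    simpa [hσ] using this
  have hσ0 : Tendsto σ atTop (𝓝 0) := by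
    simpa [hσ] using tendsto_one_div_add_atTop_nhds_zero_nat.const_mul h
  have hlim : ∀ z, ∃ l, z ∈ D → ∀ s, 0 < s → s ≤ h → |pairing Q w G s z - l| ≤ C₁ * s ^ γ := by
    intro z
    by_cases hz : z ∈ D
    swap
    · exact ⟨0, fun h => absurd h hz⟩
    have hc : CauchySeq fun k => pairing Q w G (σ k) z := by
      refine cauchySeq_of_le_tendsto_0' (fun k => C₁ * σ k ^ γ) (fun k m hkm => ?_) ?_
      · exact hcauchy z hz _ _ (hσpos m) (hσanti k m hkm) (hσh k)
      · have := (hσ0.rpow_const (Or.inr hγ.le)).const_mul C₁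
        simpa [Real.zero_rpow hγ.ne'] using this
    obtain ⟨l, hl⟩ := cauchySeq_tendsto_of_complete hc
    refine ⟨l, fun _ s hs hsh => ?_⟩
    refine le_of_tendsto (hl.const_sub (pairing Q w G s z)).abs ?_
    filter_upwards [hσ0.eventually (ge_mem_nhds hs)] with k hk
    exact hcauchy z hz _ _ (hσpos k) hk hsh
  choose v hv using hlim
  set B := (∫ y in Q, |w y|) * (h⁻¹ ^ (n + 2) * M) + C₁ * h ^ γ with hB
  have hI : 0 ≤ ∫ y in Q, |w y| := integral_nonneg fun _ => abs_nonneg _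
  have hB0 : 0 ≤ B := by positivity
  have hvB : ∀ z ∈ D, |v z| ≤ B := by
    intro z hz
    have h1 := hv z hz h hh le_rfl
    have h2 := abs_pairing_le hM hw hh z
    rw [abs_le] at h1 h2 ⊢
    constructor <;> linarith
  set C₃ := (2 * C₁ + C₂ * δ) * (δ⁻¹) ^ γ with hC₃
  set C₄ := 2 * B * ((δ * h)⁻¹) ^ γ with hC₄
  have hC₃0 : 0 ≤ C₃ := by positivity
  have hC₄0 : 0 ≤ C₄ := by positivity
  refine ⟨v, C₁ + B + C₃ + C₄, fun z hz => (hvB z hz).trans (by linarith),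
    fun z hz z' hz' => ?_, fun z hz s hs hsh => (hv z hz s hs hsh).trans ?_⟩
  swap
  · gcongr
    linarith
  have hd0 := parDist_nonneg z z'
  have hdγ : 0 ≤ parDist z z' ^ γ := Real.rpow_nonneg hd0 _
  rcases hd0.eq_or_lt with hd | hd
  · rw [eq_of_parDist_nonpos hd.ge]
    simp only [sub_self, abs_zero]
    have := parDist_nonneg z' z'
    positivity
  rcases le_or_gt (parDist z z') (δ * h) with hle | hgt
  · -- near points are compared at the scale given by their distance
    set s := δ⁻¹ * parDist z z' with hs
    have hs0 : 0 < s := by positivity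
    have hsh : s ≤ h := by rwa [hs, inv_mul_le_iff₀ hδ]
    have hds : parDist z z' = δ * s := by rw [hs, mul_inv_cancel_left₀ hδ.ne']
    have hη := norm_dil_inv_sub_le hδ1 hs0 hds
    set η := dil s⁻¹ (z' - z) with hηdef
    have h1 := norm_image_sub_le_of_norm_deriv_le_segment_01'
      (f := fun θ : ℝ => pairing Q w G s (z + θ • dil s η)) (C := C₂ * δ * s ^ γ)
      (fun θ _ => (hasDerivAt_pairing_translate hw hG hs0 z η θ).hasDerivWithinAt)
      (fun θ hθ => by
        rw [Real.norm_eq_abs, abs_neg]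
        refine (htrans s _ (admissible_translate (hD z hz) hs0 hsh hη
          (Ico_subset_Icc_self hθ)) η).trans ?_
        gcongr)
    have h2 : z + (1 : ℝ) • dil s η = z' := by
      rw [one_smul, hηdef, dil_dil_inv hs0.ne']; abel
    rw [h2, zero_smul, add_zero, Real.norm_eq_abs] at h1
    have h3 := hv z hz s hs0 hsh
    have h4 := hv z' hz' s hs0 hsh
    have h5 : s ^ γ = (δ⁻¹) ^ γ * parDist z z' ^ γ := Real.mul_rpow (by positivity) hd0
    have h6 : |v z - v z'| ≤ C₃ * parDist z z' ^ γ := by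
      rw [hC₃, mul_assoc, ← h5]
      rw [abs_le] at h1 h3 h4 ⊢
      constructor <;> linarith
    refine h6.trans ?_
    gcongr
    linarith
  · have h1 : 1 ≤ ((δ * h)⁻¹) ^ γ * parDist z z' ^ γ := by
      rw [← Real.mul_rpow (by positivity) hd0]
      refine Real.one_le_rpow ?_ hγ.le
      rw [le_inv_mul_iff₀ (by positivity), mul_one]
      exact hgt.le
    have h2 : |v z - v z'| ≤ C₄ * parDist z z' ^ γ := by
      calc |v z - v z'| ≤ |v z| + |v z'| := abs_sub _ _
        _ ≤ 2 * B * 1 := by linarith [hvB z hz, hvB z' hz']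
        _ ≤ 2 * B * (((δ * h)⁻¹) ^ γ * parDist z z' ^ γ) := by gcongr
        _ = _ := by rw [hC₄]; ring
    refine h2.trans ?_
    gcongr
    linarith

/-! ### The limit of the averages is the function itself -/

instance {n : ℕ} : (volume : Measure (ST n)).IsAddHaarMeasure :=
  Measure.prod.instIsAddHaarMeasure (volume : Measure (E n)) (volume : Measure ℝ)

lemma det_dil {n : ℕ} (r : ℝ) : (dil r : ST n →L[ℝ] ST n).det = r ^ (n + 2) := by
  have h : ((dil r : ST n →L[ℝ] ST n) : ST n →ₗ[ℝ] ST n)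
      = (r • LinearMap.id : E n →ₗ[ℝ] E n).prodMap (r ^ 2 • LinearMap.id : ℝ →ₗ[ℝ] ℝ) := rfl
  rw [ContinuousLinearMap.det, h, LinearMap.det_prodMap, LinearMap.det_smul, LinearMap.det_smul,
    LinearMap.det_id, LinearMap.det_id]
  simp [pow_add]

lemma integral_mul_kern {n : ℕ} (φ G : ST n → ℝ) {s : ℝ} (hs : 0 < s) (y : ST n) :
    ∫ z, φ z * kern G s z y = ∫ ζ, φ (y - dil s ζ) * G ζ := by
  have hinj : InjOn (dil s⁻¹ : ST n → ST n) univ :=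
    (Function.LeftInverse.injective (g := dil s) (dil_dil_inv hs.ne')).injOn
  have himg : (dil s⁻¹ : ST n → ST n) '' univ = univ := by
    rw [image_univ]
    exact (Function.RightInverse.surjective (g := dil s) (dil_inv_dil hs.ne')).range_eq
  have h1 := integral_image_eq_integral_abs_det_fderiv_smul volume MeasurableSet.univ
    (fun x _ => (dil s⁻¹ : ST n →L[ℝ] ST n).hasFDerivAt.hasFDerivWithinAt) hinj
    (fun ζ => φ (y - dil s ζ) * G ζ)
  rw [himg, setIntegral_univ, setIntegral_univ, det_dil] at h1
  rw [h1, ← integral_sub_left_eq_self _ volume y]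
  congr 1; ext x
  rw [dil_dil_inv hs.ne', abs_of_nonneg (by positivity), smul_eq_mul, kern, sub_sub_cancel]
  ring

lemma continuous_pairing {n : ℕ} {Q : Set (ST n)} {w G : ST n → ℝ} (hw : IntegrableOn w Q)
    (hc : Continuous G) (hk : HasCompactSupport G) {s : ℝ} (hs : 0 < s) :
    Continuous (pairing Q w G s) := by
  obtain ⟨M, hM0, hM⟩ := exists_bound hc hk
  refine continuous_of_dominated (bound := fun y => |w y| * (s⁻¹ ^ (n + 2) * M))
    (fun z => (integrable_mul_kern hw hc hk hs z).1) (fun z => Eventually.of_forall fun y => ?_)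
    (hw.norm.mul_const _) (Eventually.of_forall fun y => ?_)
  · rw [Real.norm_eq_abs, abs_mul]
    gcongr
    exact abs_kern_le hM hs z y
  · unfold kern
    fun_prop

/-- Weak convergence of the averages of `w` to `w`: by Fubini, averaging can be moved to the
continuous function `φ`. -/
lemma tendsto_integral_mul_pairing {n : ℕ} {Q : Set (ST n)} {w G φ : ST n → ℝ}
    (hw : IntegrableOn w Q) (hc : Continuous G) (hk : HasCompactSupport G)
    (hG1 : ∫ y, G y = 1) (hφ : Continuous φ) (hφk : HasCompactSupport φ) :
    Tendsto (fun s => ∫ z, φ z * pairing Q w G s z) (𝓝[>] 0) (𝓝 (∫ y in Q, w y * φ y)) := by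
  obtain ⟨M, hM0, hM⟩ := exists_bound hc hk
  obtain ⟨N, hN0, hN⟩ := exists_bound hφ hφk
  have hGi : Integrable G := hc.integrable_of_hasCompactSupport hk
  have hφi : Integrable φ := hφ.integrable_of_hasCompactSupport hφk
  have hswap : ∀ s : ℝ, 0 < s → ∫ z, φ z * pairing Q w G s z
      = ∫ y in Q, w y * ∫ ζ, φ (y - dil s ζ) * G ζ := by
    intro s hs
    have hint : Integrable (fun q : ST n × ST n => φ q.1 * (w q.2 * kern G s q.1 q.2))
        (volume.prod (volume.restrict Q)) := by
      have h1 : Integrable (fun q : ST n × ST n => φ q.1 * w q.2)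
        (volume.prod (volume.restrict Q)) := hφi.mul_prod hw
      have hck : Continuous fun q : ST n × ST n => kern G s q.1 q.2 := by
        unfold kern
        fun_prop
      have h2 := h1.mul_bdd (c := s⁻¹ ^ (n + 2) * M) hck.aestronglyMeasurable
        (Eventually.of_forall fun q => abs_kern_le hM hs q.1 q.2)
      simpa only [mul_assoc] using h2
    calc ∫ z, φ z * pairing Q w G s z
        = ∫ z, ∫ y in Q, φ z * (w y * kern G s z y) := by
          simp only [pairing, integral_const_mul]
      _ = ∫ y in Q, ∫ z, φ z * (w y * kern G s z y) := integral_integral_swap hint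
      _ = _ := by
          congr 1; ext y
          rw [← integral_mul_kern φ G hs, ← integral_const_mul]
          congr 1; ext z; ring
  have hinner : ∀ y, Tendsto (fun s : ℝ => ∫ ζ, φ (y - dil s ζ) * G ζ) (𝓝[>] 0) (𝓝 (φ y)) := by
    intro y
    have hy : ∫ ζ, φ y * G ζ = φ y := by rw [integral_const_mul, hG1, mul_one]
    rw [← hy]
    refine tendsto_integral_filter_of_dominated_convergence (fun ζ => N * |G ζ|)
      (Eventually.of_forall fun s => ?_) (Eventually.of_forall fun s => Eventually.of_forall
        fun ζ => ?_) (hGi.norm.const_mul N) (Eventually.of_forall fun ζ => ?_)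
    · exact (by fun_prop : Continuous fun ζ => φ (y - dil s ζ) * G ζ).aestronglyMeasurable
    · rw [Real.norm_eq_abs, abs_mul]
      gcongr
      exact hN _
    · have hcont : Continuous fun s : ℝ => φ (y - dil s ζ) * G ζ := by
        simp only [dil_apply]
        fun_prop
      have := (hcont.tendsto 0).mono_left (nhdsWithin_le_nhds (s := Ioi 0))
      have h0 : dil 0 ζ = 0 := Prod.ext (zero_smul ℝ ζ.1) (by simp [dil_apply])
      simpa [h0] using this
  have hbound : ∀ (s : ℝ) (y : ST n), |∫ ζ, φ (y - dil s ζ) * G ζ| ≤ N * ∫ ζ, |G ζ| := by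
    intro s y
    rw [← integral_const_mul]
    refine norm_integral_le_of_norm_le (f := fun ζ => φ (y - dil s ζ) * G ζ)
      (hGi.norm.const_mul N) (Eventually.of_forall fun ζ => ?_)
    rw [Real.norm_eq_abs, abs_mul]
    gcongr
    exact hN _
  refine Tendsto.congr' (f₁ := fun s => ∫ y in Q, w y * ∫ ζ, φ (y - dil s ζ) * G ζ) ?_ ?_
  · filter_upwards [self_mem_nhdsWithin] with s hs
    exact (hswap s hs).symm
  refine tendsto_integral_filter_of_dominated_convergence (fun y => |w y| * (N * ∫ ζ, |G ζ|))
    (Eventually.of_forall fun s => ?_) (Eventually.of_forall fun s => Eventually.of_forall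
      fun y => ?_) (hw.norm.mul_const _) (Eventually.of_forall fun y => (hinner y).const_mul _)
  · refine hw.1.mul ?_
    have hcont : Continuous fun y => ∫ ζ, φ (y - dil s ζ) * G ζ := by
      refine continuous_of_dominated (bound := fun ζ => N * |G ζ|) (fun y => ?_)
        (fun y => Eventually.of_forall fun ζ => ?_) (hGi.norm.const_mul N)
        (Eventually.of_forall fun ζ => by fun_prop)
      · exact (by fun_prop : Continuous fun ζ => φ (y - dil s ζ) * G ζ).aestronglyMeasurable
      · rw [Real.norm_eq_abs, abs_mul]
        gcongr
        exact hN _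
    exact hcont.aestronglyMeasurable
  · rw [Real.norm_eq_abs, abs_mul]
    gcongr
    exact hbound s y

lemma continuousOn_of_parDist {n : ℕ} {v : ST n → ℝ} {D : Set (ST n)} {C γ : ℝ} (hγ : 0 < γ)
    (h : ∀ z ∈ D, ∀ z' ∈ D, |v z - v z'| ≤ C * parDist z z' ^ γ) : ContinuousOn v D := by
  intro z hz
  have hcont : Continuous fun z' : ST n => C * parDist z' z ^ γ := by
    unfold parDist
    have h1 : Continuous fun z' : ST n => ‖z'.1 - z.1‖ + √|z'.2 - z.2| := by fun_prop
    exact continuous_const.mul (h1.rpow_const fun _ => Or.inr hγ.le)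
  rw [ContinuousWithinAt, tendsto_iff_dist_tendsto_zero]
  have h0 : Tendsto (fun z' : ST n => C * parDist z' z ^ γ) (𝓝[D] z) (𝓝 0) := by
    have := (hcont.tendsto z).mono_left (nhdsWithin_le_nhds (s := D))
    simpa [parDist, Real.zero_rpow hγ.ne'] using this
  refine squeeze_zero' (Eventually.of_forall fun _ => dist_nonneg) ?_ h0
  filter_upwards [self_mem_nhdsWithin] with z' hz'
  exact h z' hz' z hz

lemma ae_eq_of_pairing_limit {n : ℕ} {Q V : Set (ST n)} {w G v : ST n → ℝ} {C γ h : ℝ}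
    (hQ : MeasurableSet Q) (hV : IsOpen V) (hVQ : V ⊆ Q) (hw : IntegrableOn w Q)
    (hc : Continuous G) (hk : HasCompactSupport G) (hG1 : ∫ y, G y = 1) (hγ : 0 < γ) (hh : 0 < h)
    (hv : ContinuousOn v V)
    (hlim : ∀ z ∈ V, ∀ s, 0 < s → s ≤ h → |pairing Q w G s z - v z| ≤ C * s ^ γ) :
    ∀ᵐ z ∂volume, z ∈ V → w z = v z := by
  have hwV : LocallyIntegrableOn w V := (hw.mono_set hVQ).locallyIntegrableOn
  have hvV : LocallyIntegrableOn v V := hv.locallyIntegrableOn hV.measurableSet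
  have key := hV.ae_eq_zero_of_integral_contDiff_smul_eq_zero (f := fun z => w z - v z)
    (μ := volume) (hwV.sub hvV) ?_
  · filter_upwards [key] with z hz hzV
    exact sub_eq_zero.1 (hz hzV)
  intro φ hφ hφk hφV
  have hφc := hφ.continuous
  have hφ0 : ∀ z, z ∉ V → φ z = 0 := fun z hz =>
    image_eq_zero_of_notMem_tsupport fun h => hz (hφV h)
  have hφi : Integrable φ := hφc.integrable_of_hasCompactSupport hφk
  have hφv : Continuous fun z => φ z * v z := by
    refine continuous_iff_continuousAt.2 fun z => ?_
    by_cases hz : z ∈ V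
    · exact hφc.continuousAt.mul (hv.continuousAt (hV.mem_nhds hz))
    · have hz' : z ∉ tsupport φ := fun h => hz (hφV h)
      have h0 : (fun z => φ z * v z) =ᶠ[𝓝 z] fun _ => 0 := by
        filter_upwards [(isClosed_tsupport φ).isOpen_compl.mem_nhds hz'] with y hy
        rw [image_eq_zero_of_notMem_tsupport hy, zero_mul]
      exact (continuousAt_const).congr h0.symm
  have hφvi : Integrable fun z => φ z * v z :=
    hφv.integrable_of_hasCompactSupport hφk.mul_right
  have hφwi : Integrable fun z => φ z * w z := by
    obtain ⟨N, -, hN⟩ := exists_bound hφc hφk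
    have h1 : Integrable (Q.indicator w) := hw.integrable_indicator hQ
    have h2 := h1.bdd_mul (c := N) hφc.aestronglyMeasurable (Eventually.of_forall hN)
    refine h2.congr (Eventually.of_forall fun z => ?_)
    by_cases hz : z ∈ Q
    · simp [hz]
    · simp [hz, hφ0 z fun h => hz (hVQ h)]
  have hA := tendsto_integral_mul_pairing hw hc hk hG1 hφc hφk
  have hA' : ∫ y in Q, w y * φ y = ∫ z, φ z * w z := by
    rw [← integral_indicator hQ]
    congr 1; ext z
    by_cases hz : z ∈ Q
    · simp [hz, mul_comm]
    · simp [hz, hφ0 z fun h => hz (hVQ h)]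
  have hB : Tendsto (fun s => ∫ z, φ z * pairing Q w G s z) (𝓝[>] 0) (𝓝 (∫ z, φ z * v z)) := by
    rw [tendsto_iff_dist_tendsto_zero]
    have h0 : Tendsto (fun s : ℝ => (∫ z, |φ z|) * (C * s ^ γ)) (𝓝[>] 0) (𝓝 0) := by
      have h1 : Continuous fun s : ℝ => (∫ z, |φ z|) * (C * s ^ γ) :=
        continuous_const.mul (continuous_const.mul (Real.continuous_rpow_const hγ.le))
      have := (h1.tendsto 0).mono_left (nhdsWithin_le_nhds (s := Ioi 0))
      simpa [Real.zero_rpow hγ.ne'] using this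
    refine squeeze_zero' (Eventually.of_forall fun _ => dist_nonneg) ?_ h0
    filter_upwards [Ioc_mem_nhdsGT hh] with s hs
    have hpi : Integrable fun z => φ z * pairing Q w G s z :=
      (hφc.mul (continuous_pairing hw hc hk hs.1)).integrable_of_hasCompactSupport hφk.mul_right
    rw [Real.dist_eq, ← integral_sub hpi hφvi, ← integral_mul_const]
    refine norm_integral_le_of_norm_le (f := fun z => φ z * pairing Q w G s z - φ z * v z)
      (hφi.norm.mul_const _) (Eventually.of_forall fun z => ?_)
    rw [← mul_sub, Real.norm_eq_abs, abs_mul]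
    by_cases hz : z ∈ V
    · gcongr
      exact hlim z hz s hs.1 hs.2
    · simp [hφ0 z hz]
  have heq := tendsto_nhds_unique hA hB
  rw [hA'] at heq
  simp only [smul_eq_mul, mul_sub]
  rw [integral_sub hφwi hφvi, heq, sub_self]

lemma exists_isTest_integral_one {n : ℕ} (b : ST n) {δ : ℝ} (hδ : 0 < δ) :
    ∃ G : ST n → ℝ, IsTest (Metric.ball b δ) G ∧ ∫ y, G y = 1 := by
  let f : ContDiffBump b := ⟨δ / 4, δ / 2, by positivity, by linarith⟩
  refine ⟨f.normed volume, ⟨f.contDiff_normed, ?_⟩, f.integral_normed⟩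
  rw [f.tsupport_normed_eq]
  exact Metric.closedBall_subset_ball (by change δ / 2 < δ; linarith)

/-! ### The interior cone condition -/

/-- The part of `y` orthogonal to `ν` varies in a Lipschitz way; the constant is not optimal. -/
lemma norm_sub_inner_smul_le {n : ℕ} {ν : E n} (hν : ‖ν‖ = 1) (y : E n) :
    ‖y - (inner ℝ y ν : ℝ) • ν‖ ≤ 2 * ‖y‖ := by
  have h1 : |inner ℝ y ν| ≤ ‖y‖ := by simpa [hν] using abs_real_inner_le_norm y ν
  calc _ ≤ ‖y‖ + ‖(inner ℝ y ν : ℝ) • ν‖ := norm_sub_le _ _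
    _ ≤ 2 * ‖y‖ := by rw [norm_smul, hν, Real.norm_eq_abs]; linarith

/-- Uniform interior cone condition near any point of the closure of `Ω`. At a boundary point the
axis of the cone points vertically downwards, away from the graph. -/
lemma IsBoundedC21Domain.exists_cone {n : ℕ} {Ω : Set (E n)} (hΩ : IsBoundedC21Domain Ω)
    {x₀ : E n} (hx₀ : x₀ ∈ closure Ω) :
    ∃ (e : E n) (δ r h : ℝ), 0 < δ ∧ 0 < r ∧ 0 < h ∧ ∀ x ∈ closure Ω, x ∈ Metric.ball x₀ r →
      ∀ s, 0 < s → s ≤ h → ∀ y ∈ Metric.ball e δ, x + s • y ∈ Ω := by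
  by_cases hin : x₀ ∈ Ω
  · obtain ⟨ρ, hρ, hball⟩ := Metric.isOpen_iff.1 hΩ.isOpen x₀ hin
    refine ⟨0, 1, ρ / 2, ρ / 2, one_pos, by positivity, by positivity,
      fun x _ hx s hs hsh y hy => hball ?_⟩
    rw [Metric.mem_ball, dist_eq_norm] at hx
    rw [mem_ball_zero_iff] at hy
    rw [Metric.mem_ball, dist_eq_norm]
    have h1 : ‖s • y‖ ≤ ρ / 2 := by
      rw [norm_smul, Real.norm_of_nonneg hs.le]
      nlinarith [norm_nonneg y]
    calc ‖x + s • y - x₀‖ = ‖(x - x₀) + s • y‖ := by congr 1; abel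
      _ ≤ ‖x - x₀‖ + ‖s • y‖ := norm_add_le _ _
      _ < ρ := by linarith
  have hfr : x₀ ∈ frontier Ω := by
    rw [hΩ.isOpen.frontier_eq]; exact ⟨hx₀, hin⟩
  obtain ⟨ν, r₀, g, -, hν, hr₀, hg, -, hgraph⟩ := hΩ.boundary x₀ hfr
  set P : E n → E n := fun y => y - (inner ℝ y ν : ℝ) • ν with hP
  have hPc : Continuous P := by fun_prop
  have hPadd : ∀ y y', P (y + y') = P y + P y' := fun y y' => by
    simp only [hP, inner_add_left, add_smul]; abel
  have hPsmul : ∀ (s : ℝ) y, P (s • y) = s • P y := fun s y => by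
    simp only [hP, real_inner_smul_left, smul_sub, smul_smul]
  have hPsub : ∀ y y', P y - P y' = P (y - y') := fun y y' => by
    simp only [hP, inner_sub_left, sub_smul]; abel
  have hνν : inner ℝ ν ν = (1 : ℝ) := by rw [real_inner_self_eq_norm_sq, hν, one_pow]
  have hPν : P ν = 0 := by simp only [hP, hνν, one_smul, sub_self]
  obtain ⟨K, t, ht, hlip⟩ := ((hg.of_le (by norm_num)).contDiffAt (x := P x₀) :
    ContDiffAt ℝ 1 g (P x₀)).exists_lipschitzOnWith
  obtain ⟨ρ, hρ, hρt⟩ := Metric.mem_nhds_iff.1 ht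
  -- the aperture is chosen such that the slope of the cone exceeds the Lipschitz constant of `g`
  set δ : ℝ := 1 / (2 * (1 + 2 * K)) with hδ
  have hK0 : (0 : ℝ) ≤ K := K.2
  have hδ0 : 0 < δ := by positivity
  have hδK : δ * (1 + 2 * K) = 1 / 2 := by rw [hδ]; field_simp
  have hδ1 : δ ≤ 1 / 2 := by nlinarith
  set r : ℝ := min (r₀ / 2) (ρ / 4) with hr
  have hr0 : 0 < r := by positivity
  have hr1 : 2 * r ≤ r₀ := by have := min_le_left (r₀ / 2) (ρ / 4); linarith
  have hr2 : 4 * r ≤ ρ := by have := min_le_right (r₀ / 2) (ρ / 4); linarith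
  have hPt : ∀ x ∈ Metric.ball x₀ (2 * r), P x ∈ t := by
    intro x hx
    refine hρt ?_
    rw [Metric.mem_ball, dist_eq_norm] at hx ⊢
    rw [hPsub]
    have : ‖P (x - x₀)‖ ≤ 2 * ‖x - x₀‖ := norm_sub_inner_smul_le hν _
    linarith
  refine ⟨-ν, δ, r, r / 2, hδ0, hr0, by positivity, fun x hxc hx s hs hsh y hy => ?_⟩
  have hxle : inner ℝ x ν ≤ g (P x) := by
    have h1 : x ∈ closure (Metric.ball x₀ r₀ ∩ Ω) :=
      Metric.isOpen_ball.inter_closure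
        ⟨Metric.ball_subset_ball (by linarith) hx, hxc⟩
    have h2 : IsClosed {y : E n | inner ℝ y ν ≤ g (P y)} :=
      isClosed_le (by fun_prop) (hg.continuous.comp hPc)
    exact closure_minimal (fun y hy => ((hgraph y hy.1).1 hy.2).le) h2 h1
  set q := y + ν with hq
  have hqδ : ‖q‖ < δ := by
    rw [Metric.mem_ball, dist_eq_norm, sub_neg_eq_add] at hy
    exact hy
  have hyq : y = q - ν := by rw [hq]; abel
  have hy2 : ‖y‖ ≤ 2 := by
    rw [hyq]
    have := norm_sub_le q ν
    linarith
  have hx' : x + s • y ∈ Metric.ball x₀ (2 * r) := by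
    rw [Metric.mem_ball, dist_eq_norm] at hx ⊢
    have h1 : ‖s • y‖ ≤ r := by
      rw [norm_smul, Real.norm_of_nonneg hs.le]
      nlinarith [norm_nonneg y]
    calc ‖x + s • y - x₀‖ = ‖(x - x₀) + s • y‖ := by congr 1; abel
      _ ≤ ‖x - x₀‖ + ‖s • y‖ := norm_add_le _ _
      _ < 2 * r := by linarith
  refine (hgraph _ (Metric.ball_subset_ball hr1 hx')).2 ?_
  change inner ℝ (x + s • y) ν < g (P (x + s • y))
  have hin1 : inner ℝ y ν ≤ -1 + δ := by
    rw [hyq, inner_sub_left, hνν]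
    have : inner ℝ q ν ≤ ‖q‖ := by simpa [hν] using real_inner_le_norm q ν
    linarith
  have hPy : P y = P q := by rw [hyq, ← hPsub, hPν, sub_zero]
  have hglip : |g (P (x + s • y)) - g (P x)| ≤ K * (s * (2 * δ)) := by
    have h1 := hlip.dist_le_mul _ (hPt _ hx') _
      (hPt x (Metric.ball_subset_ball (by linarith) hx))
    have h2 : ‖P q‖ ≤ 2 * ‖q‖ := norm_sub_inner_smul_le hν q
    have h3 : dist (P (x + s • y)) (P x) ≤ s * (2 * δ) := by
      rw [dist_eq_norm, hPadd, add_sub_cancel_left, hPsmul, hPy, norm_smul,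
        Real.norm_of_nonneg hs.le]
      gcongr
      linarith
    exact h1.trans (mul_le_mul_of_nonneg_left h3 hK0)
  rw [inner_add_left, real_inner_smul_left]
  have h3 : s * inner ℝ y ν ≤ s * (-1 + δ) := by gcongr
  have h4 : s * δ * (1 + 2 * K) = s * (1 / 2) := by rw [mul_assoc, hδK]
  rw [abs_le] at hglip
  nlinarith [hglip.1]

/-- In the time direction the averages look forward near times `t₀ < T` and backward near `T`. -/
lemma exists_time_direction {T t₀ : ℝ} (hT : 0 < T) (ht₀ : t₀ ≤ T) :
    ∃ τ r h : ℝ, 0 < r ∧ 0 < h ∧ ∀ t ∈ Icc 0 T, t ∈ Metric.ball t₀ r → ∀ s, 0 < s → s ≤ h →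
      ∀ σ ∈ Metric.ball τ (1 / 2), t + s ^ 2 * σ ∈ Ioo 0 T := by
  rcases ht₀.lt_or_eq with hlt | rfl
  · refine ⟨1, (T - t₀) / 2, min 1 ((T - t₀) / 4), by linarith,
      lt_min one_pos (by linarith), fun t ht htr s hs hsh σ hσ => ?_⟩
    have h1 := hsh.trans (min_le_left _ _)
    have h2 := hsh.trans (min_le_right _ _)
    rw [Metric.mem_ball, Real.dist_eq, abs_lt] at htr hσ
    have h3 : s ^ 2 ≤ s := by nlinarith
    have h4 : 0 < s ^ 2 := by positivity
    have h5 : 0 < s ^ 2 * σ := mul_pos h4 (by linarith)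
    have h6 : s ^ 2 * σ ≤ s ^ 2 * (3 / 2) := by gcongr; linarith
    exact ⟨by linarith [ht.1], by linarith⟩
  · refine ⟨-1, t₀ / 2, min 1 (t₀ / 4), by linarith,
      lt_min one_pos (by linarith), fun t ht htr s hs hsh σ hσ => ?_⟩
    have h1 := hsh.trans (min_le_left _ _)
    have h2 := hsh.trans (min_le_right _ _)
    rw [Metric.mem_ball, Real.dist_eq, abs_lt] at htr hσ
    have h3 : s ^ 2 ≤ s := by nlinarith
    have h4 : 0 < s ^ 2 := by positivity
    have h5 : 0 < s ^ 2 * -σ := mul_pos h4 (by linarith)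
    have h6 : s ^ 2 * -σ ≤ s ^ 2 * (3 / 2) := by gcongr; linarith
    exact ⟨by linarith, by linarith [ht.2]⟩

lemma closure_cyl {n : ℕ} (Ω : Set (E n)) {T : ℝ} (hT : 0 < T) :
    closure (cyl Ω T) = closure Ω ×ˢ Icc 0 T := by
  rw [cyl, closure_prod_eq, closure_Ioo hT.ne]

lemma IsBoundedC21Domain.exists_parabolic_cone {n : ℕ} {Ω : Set (E n)}
    (hΩ : IsBoundedC21Domain Ω) {T : ℝ} (hT : 0 < T) {z₀ : ST n} (hz₀ : z₀ ∈ closure (cyl Ω T)) :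
    ∃ (b : ST n) (δ r h : ℝ), 0 < δ ∧ δ ≤ 1 ∧ 0 < r ∧ 0 < h ∧
      ∀ z ∈ closure (cyl Ω T) ∩ Metric.ball z₀ r, ∀ s, 0 < s → s ≤ h →
        ∀ y ∈ Metric.ball b (2 * δ), z + dil s y ∈ cyl Ω T := by
  rw [closure_cyl Ω hT] at *
  obtain ⟨e, δ, r, h, hδ, hr, hh, H⟩ := hΩ.exists_cone hz₀.1
  obtain ⟨τ, r', h', hr', hh', H'⟩ := exists_time_direction hT hz₀.2.2
  refine ⟨(e, τ), min δ (1 / 2) / 2, min r r', min h h', by positivity,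
    by have := min_le_right δ (1 / 2); linarith, by positivity, by positivity,
    fun z hz s hs hsh y hy => ?_⟩
  rw [mul_div_cancel₀ _ (two_ne_zero), ← ball_prod_same] at hy
  obtain ⟨⟨hzΩ, hzT⟩, hzb⟩ := hz
  rw [← Prod.mk.eta (p := z₀), ← ball_prod_same] at hzb
  exact ⟨H _ hzΩ (Metric.ball_subset_ball (min_le_left _ _) hzb.1) s hs
      (hsh.trans (min_le_left _ _)) _ (Metric.ball_subset_ball (min_le_left _ _) hy.1),
    H' _ hzT (Metric.ball_subset_ball (min_le_right _ _) hzb.2) s hs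
      (hsh.trans (min_le_right _ _)) _ (Metric.ball_subset_ball (min_le_right _ _) hy.2)⟩

/-! ### From local to global Hölder continuity -/

lemma parDist_comm {n : ℕ} (z z' : ST n) : parDist z z' = parDist z' z := by
  rw [parDist, parDist, norm_sub_rev, abs_sub_comm]

lemma parDist_triangle {n : ℕ} (x y z : ST n) : parDist x z ≤ parDist x y + parDist y z := by
  have h1 : ‖x.1 - z.1‖ ≤ ‖x.1 - y.1‖ + ‖y.1 - z.1‖ := norm_sub_le_norm_sub_add_norm_sub _ _ _
  have h2 : √|x.2 - z.2| ≤ √|x.2 - y.2| + √|y.2 - z.2| := by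
    refine Real.sqrt_le_iff.2 ⟨by positivity, ?_⟩
    have h3 := abs_sub_le x.2 y.2 z.2
    nlinarith [Real.sq_sqrt (abs_nonneg (x.2 - y.2)), Real.sq_sqrt (abs_nonneg (y.2 - z.2)),
      mul_nonneg (Real.sqrt_nonneg |x.2 - y.2|) (Real.sqrt_nonneg |y.2 - z.2|)]
  unfold parDist
  linarith

lemma parDist_rpow_triangle {n : ℕ} {γ : ℝ} (hγ : 0 < γ) (hγ1 : γ ≤ 1) (x y z : ST n) :
    parDist x z ^ γ ≤ parDist x y ^ γ + parDist y z ^ γ :=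
  (Real.rpow_le_rpow (parDist_nonneg _ _) (parDist_triangle x y z) hγ.le).trans
    (Real.rpow_add_le_add_rpow (parDist_nonneg _ _) (parDist_nonneg _ _) hγ.le hγ1)

lemma parDist_self {n : ℕ} (z : ST n) : parDist z z = 0 := by simp [parDist]

/-- McShane extension for the parabolic distance: `v z = inf_a (w a + C d(z, a) ^ γ)`. -/
lemma exists_holder_extension {n : ℕ} {A : Set (ST n)} {w : ST n → ℝ} {C γ : ℝ} (hC : 0 ≤ C)
    (hγ : 0 < γ) (hγ1 : γ ≤ 1)
    (h : ∀ z ∈ A, ∀ z' ∈ A, |w z - w z'| ≤ C * parDist z z' ^ γ) :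
    ∃ v : ST n → ℝ, (∀ z ∈ A, w z = v z) ∧ ∀ z z', |v z - v z'| ≤ C * parDist z z' ^ γ := by
  rcases A.eq_empty_or_nonempty with rfl | ⟨a₀, ha₀⟩
  · refine ⟨0, by simp, fun z z' => ?_⟩
    have := Real.rpow_nonneg (parDist_nonneg z z') γ
    simpa using mul_nonneg hC this
  have : Nonempty A := ⟨⟨a₀, ha₀⟩⟩
  have hbdd : ∀ z : ST n, BddBelow (range fun a : A => w a + C * parDist z a ^ γ) := by
    refine fun z => ⟨w a₀ - C * parDist a₀ z ^ γ, ?_⟩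
    rintro _ ⟨a, rfl⟩
    have h1 := le_of_abs_le (h a₀ ha₀ a a.2)
    have h2 := mul_le_mul_of_nonneg_left (parDist_rpow_triangle hγ hγ1 a₀ z a) hC
    dsimp only
    linarith
  set v : ST n → ℝ := fun z => ⨅ a : A, (w a + C * parDist z a ^ γ) with hv
  have hle : ∀ z z', v z - v z' ≤ C * parDist z z' ^ γ := by
    intro z z'
    have : v z - C * parDist z z' ^ γ ≤ v z' := by
      refine le_ciInf fun a => ?_
      have h1 : v z ≤ w a + C * parDist z a ^ γ := ciInf_le (hbdd z) a
      have h2 := mul_le_mul_of_nonneg_left (parDist_rpow_triangle hγ hγ1 z z' a) hC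
      linarith
    linarith
  refine ⟨v, fun z hz => le_antisymm (le_ciInf fun a => ?_) ?_, fun z z' => ?_⟩
  · have := le_of_abs_le (h z hz a a.2)
    linarith
  · have h1 : v z ≤ w z + C * parDist z z ^ γ := ciInf_le (hbdd z) ⟨z, hz⟩
    rwa [parDist_self, Real.zero_rpow hγ.ne', mul_zero, add_zero] at h1
  · rw [abs_le]
    have h1 := hle z' z
    rw [parDist_comm] at h1
    exact ⟨by linarith, hle z z'⟩

lemma min_sqrt_le_parDist {n : ℕ} {z z' : ST n} {r : ℝ} (h : r ≤ dist z z') :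
    min r √r ≤ parDist z z' := by
  rw [Prod.dist_eq, le_max_iff, dist_eq_norm, Real.dist_eq] at h
  have h1 := norm_nonneg (z.1 - z'.1)
  have h2 := Real.sqrt_nonneg |z.2 - z'.2|
  unfold parDist
  rcases h with h | h
  · exact (min_le_left _ _).trans (by linarith)
  · exact (min_le_right _ _).trans (by linarith [Real.sqrt_le_sqrt h])

lemma exists_parDist_le {n : ℕ} {S : Set (ST n)} (hS : Bornology.IsBounded S) :
    ∃ R, 0 ≤ R ∧ ∀ z ∈ S, parDist z 0 ≤ R := by
  obtain ⟨R, hR⟩ := hS.exists_norm_le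
  refine ⟨|R| + √|R|, by positivity, fun z hz => ?_⟩
  have h1 := (hR z hz).trans (le_abs_self R)
  have h2 := norm_snd_le z
  rw [Real.norm_eq_abs] at h2
  simp only [parDist, Prod.fst_zero, Prod.snd_zero, sub_zero]
  exact add_le_add ((norm_fst_le z).trans h1) (Real.sqrt_le_sqrt (h2.trans h1))

/-- A function that agrees almost everywhere in `Q`, locally up to the boundary, with Hölder
continuous functions agrees with one that is Hölder continuous on the closure of `Q`. -/
theorem exists_holder_of_local {n : ℕ} {Q : Set (ST n)} (hQm : MeasurableSet Q)
    (hQ : Bornology.IsBounded Q) {w : ST n → ℝ} {γ : ℝ} (hγ : 0 < γ) (hγ1 : γ ≤ 1)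
    (hloc : ∀ z₀ ∈ closure Q, ∃ (r : ℝ) (v : ST n → ℝ) (C : ℝ), 0 < r ∧
      (∀ᵐ z ∂volume, z ∈ Q ∩ Metric.ball z₀ r → w z = v z) ∧
      (∀ z ∈ Q ∩ Metric.ball z₀ r, |v z| ≤ C) ∧
      ∀ z ∈ Q ∩ Metric.ball z₀ r, ∀ z' ∈ Q ∩ Metric.ball z₀ r,
        |v z - v z'| ≤ C * parDist z z' ^ γ) :
    ∃ v : ST n → ℝ, w =ᵐ[volume.restrict Q] v ∧ ParabolicHolderOn γ v (closure Q) := by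
  choose! r v C hr hae hbd hhol using hloc
  have hK : IsCompact (closure Q) := hQ.isCompact_closure
  obtain ⟨t, htQ, hcov⟩ := hK.elim_nhds_subcover (fun x => Metric.ball x (r x))
    fun x hx => Metric.ball_mem_nhds x (hr x hx)
  obtain ⟨ε, hε, hleb⟩ := lebesgue_number_lemma_of_metric (ι := t) hK
    (c := fun x => Metric.ball (x : ST n) (r x)) (fun _ => Metric.isOpen_ball)
    (by rwa [← iUnion_subtype (fun x => x ∈ t) fun x => Metric.ball (x : ST n) (r x)] at hcov)
  set M := ∑ x ∈ t, |C x| with hM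
  have hM0 : 0 ≤ M := Finset.sum_nonneg fun _ _ => abs_nonneg _
  have hCM : ∀ x ∈ t, C x ≤ M := fun x hx =>
    (le_abs_self _).trans (Finset.single_le_sum (f := fun x => |C x|)
      (fun _ _ => abs_nonneg _) hx)
  set A : Set (ST n) := {z | z ∈ Q ∧ ∀ x ∈ t, z ∈ Q ∩ Metric.ball x (r x) → w z = v x z} with hA
  have hAae : ∀ᵐ z ∂volume.restrict Q, z ∈ A := by
    rw [ae_restrict_iff' hQm]
    have h1 : ∀ᵐ z ∂(volume : Measure (ST n)), ∀ x ∈ t,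
        z ∈ Q ∩ Metric.ball x (r x) → w z = v x z :=
      (Finset.eventually_all t).2 fun x hx => hae x (htQ x hx)
    filter_upwards [h1] with z hz hzQ
    exact ⟨hzQ, hz⟩
  have hAbd : ∀ z ∈ A, |w z| ≤ M := by
    intro z hz
    obtain ⟨x, hx, hzx⟩ := mem_iUnion₂.1 (hcov (subset_closure hz.1))
    rw [hz.2 x hx ⟨hz.1, hzx⟩]
    exact (hbd x (htQ x hx) z ⟨hz.1, hzx⟩).trans (hCM x hx)
  set d := min ε √ε with hd
  have hd0 : 0 < d := lt_min hε (Real.sqrt_pos.2 hε)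
  set N := M + 2 * M * (d⁻¹) ^ γ with hN
  have hN0 : 0 ≤ N := by positivity
  have hAhol : ∀ z ∈ A, ∀ z' ∈ A, |w z - w z'| ≤ N * parDist z z' ^ γ := by
    intro z hz z' hz'
    have hp := parDist_nonneg z z'
    have hpγ : 0 ≤ parDist z z' ^ γ := Real.rpow_nonneg hp _
    rcases lt_or_ge (dist z z') ε with hlt | hge
    · obtain ⟨⟨x, hx⟩, hsub⟩ := hleb z (subset_closure hz.1)
      have h1 : z ∈ Q ∩ Metric.ball x (r x) := ⟨hz.1, hsub (Metric.mem_ball_self hε)⟩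
      have h2 : z' ∈ Q ∩ Metric.ball x (r x) := ⟨hz'.1, hsub (Metric.mem_ball'.2 hlt)⟩
      rw [hz.2 x hx h1, hz'.2 x hx h2]
      refine (hhol x (htQ x hx) z h1 z' h2).trans ?_
      gcongr
      refine (hCM x hx).trans ?_
      rw [hN]
      exact le_add_of_nonneg_right (by positivity)
    · have h1 : 1 ≤ (d⁻¹) ^ γ * parDist z z' ^ γ := by
        rw [← Real.mul_rpow (by positivity) hp]
        refine Real.one_le_rpow ?_ hγ.le
        rw [le_inv_mul_iff₀ hd0, mul_one]
        exact min_sqrt_le_parDist hge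
      calc |w z - w z'| ≤ |w z| + |w z'| := abs_sub _ _
        _ ≤ 2 * M * 1 := by linarith [hAbd z hz, hAbd z' hz']
        _ ≤ 2 * M * ((d⁻¹) ^ γ * parDist z z' ^ γ) := by gcongr
        _ ≤ N * parDist z z' ^ γ := by
          rw [hN, add_mul, mul_assoc (2 * M)]
          exact le_add_of_nonneg_left (by positivity)
  obtain ⟨v', hv'A, hv'⟩ := exists_holder_extension hN0 hγ hγ1 hAhol
  refine ⟨v', hAae.mono fun z hz => hv'A z hz, ?_⟩
  obtain ⟨R, hR0, hR⟩ := exists_parDist_le hQ.closure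
  have hpos : 0 ≤ |v' 0| + N * R ^ γ := by positivity
  refine ⟨N + (|v' 0| + N * R ^ γ), fun z hz => ?_, fun z _ z' _ => ?_⟩
  · have h1 : N * parDist z 0 ^ γ ≤ N * R ^ γ := by
      gcongr
      · exact parDist_nonneg _ _
      · exact hR z hz
    have h2 := hv' z 0
    have h3 := abs_sub_abs_le_abs_sub (v' z) (v' 0)
    linarith
  · refine (hv' z z').trans ?_
    change _ ≤ _ * parDist z z' ^ γ
    have := Real.rpow_nonneg (parDist_nonneg z z') γ
    gcongr
    linarith

/-! ### Parabolic Sobolev embedding -/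

lemma isBounded_cyl {n : ℕ} {Ω : Set (E n)} (hΩ : IsBoundedC21Domain Ω) (T : ℝ) :
    Bornology.IsBounded (cyl Ω T) := hΩ.isBounded.prod (Metric.isBounded_Ioo 0 T)

lemma isOpen_cyl {n : ℕ} {Ω : Set (E n)} (hΩ : IsBoundedC21Domain Ω) (T : ℝ) :
    IsOpen (cyl Ω T) := hΩ.isOpen.prod isOpen_Ioo

theorem exists_holder_of_derivGrowth {n : ℕ} {Ω : Set (E n)} (hΩ : IsBoundedC21Domain Ω)
    {T : ℝ} (hT : 0 < T) {w : ST n → ℝ} {γ : ℝ} (hγ : 0 < γ) (hγ1 : γ ≤ 1)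
    (hw : IntegrableOn w (cyl Ω T)) (hg : ∀ b δ h, DerivGrowth (cyl Ω T) b δ h w γ) :
    ∃ v : ST n → ℝ, w =ᵐ[cylMeasure Ω T] v ∧ ParabolicHolderOn γ v (closure (cyl Ω T)) := by
  refine exists_holder_of_local (isOpen_cyl hΩ T).measurableSet (isBounded_cyl hΩ T) hγ hγ1
    fun z₀ hz₀ => ?_
  obtain ⟨b, δ, r, h, hδ, hδ1, hr, hh, hD⟩ := hΩ.exists_parabolic_cone hT hz₀
  obtain ⟨G, hG, hG1⟩ := exists_isTest_integral_one b hδ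
  obtain ⟨v, C, hbd, hhol, hlim⟩ := (hg b δ h).exists_limit hw hγ hδ hδ1 hh hD hG
  have hsub : cyl Ω T ∩ Metric.ball z₀ r ⊆ closure (cyl Ω T) ∩ Metric.ball z₀ r :=
    inter_subset_inter_left _ subset_closure
  refine ⟨r, v, C, hr, ?_, fun z hz => hbd z (hsub hz),
    fun z hz z' hz' => hhol z (hsub hz) z' (hsub hz')⟩
  exact ae_eq_of_pairing_limit (isOpen_cyl hΩ T).measurableSet
    ((isOpen_cyl hΩ T).inter Metric.isOpen_ball) inter_subset_left hw hG.smooth.continuous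
    hG.hasCompactSupport hG1 hγ hh ((continuousOn_of_parDist hγ hhol).mono hsub)
    fun z hz => hlim z (hsub hz)

lemma integrableOn_of_memLp {n : ℕ} {Ω : Set (E n)} (hΩ : IsBoundedC21Domain Ω) {T p : ℝ}
    (hp : 1 ≤ p) {w : ST n → ℝ} (hw : MemLp w (ENNReal.ofReal p) (cylMeasure Ω T)) :
    IntegrableOn w (cyl Ω T) := by
  have : IsFiniteMeasure (cylMeasure Ω T) :=
    isFiniteMeasure_restrict.2 (isBounded_cyl hΩ T).measure_lt_top.ne
  exact hw.integrable (by simpa using hp)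

/-- First derivatives of `u` have smoothness of order `γ ≤ 1 - (n + 2) / p`. -/
lemma HasW21Derivs.derivGrowth_Du {n : ℕ} {Ω : Set (E n)} (hΩ : IsBoundedC21Domain Ω) {T p : ℝ}
    (hp : 1 ≤ p) {u : ST n → ℝ} {Du : Fin n → ST n → ℝ} {D2u : Fin n → Fin n → ST n → ℝ}
    {ut : ST n → ℝ} (hu : HasW21Derivs Ω T p u Du D2u ut) {γ : ℝ}
    (hγ : γ ≤ 1 - ((n : ℝ) + 2) / p) (i : Fin n) (b : ST n) (δ h : ℝ) :
    DerivGrowth (cyl Ω T) b δ h (Du i) γ := by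
  have hγ' : γ - 1 ≤ -((n : ℝ) + 2) / p := by rw [neg_div]; linarith
  have hQ := isBounded_cyl hΩ T
  refine derivGrowth_of_coord (integrableOn_of_memLp hΩ hp (hu.memLp_Du i)) (fun j G hG => ?_)
    fun G hG => ?_
  · simpa using (hu.deriv_D2u i j).growth_ex hQ
      (growth_of_memLp hp (hu.memLp_D2u i j) b δ h hγ') G hG
  · simpa using growth_et_of_mixed hQ (hu.deriv_Du i) hu.deriv_ut
      (growth_of_memLp hp hu.memLp_ut b δ h hγ') G hG

/-- `u` has smoothness of order `γ ≤ 2 - (n + 2) / p`, if `γ < 1`. -/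
lemma HasW21Derivs.derivGrowth {n : ℕ} {Ω : Set (E n)} (hΩ : IsBoundedC21Domain Ω) {T p : ℝ}
    (hp : 1 ≤ p) {u : ST n → ℝ} {Du : Fin n → ST n → ℝ} {D2u : Fin n → Fin n → ST n → ℝ}
    {ut : ST n → ℝ} (hu : HasW21Derivs Ω T p u Du D2u ut) {γ : ℝ}
    (hγ : γ ≤ 2 - ((n : ℝ) + 2) / p) (hγ1 : γ < 1) (b : ST n) (δ h : ℝ) :
    DerivGrowth (cyl Ω T) b δ h u γ := by
  have hγ' : γ - 2 ≤ -((n : ℝ) + 2) / p := by rw [neg_div]; linarith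
  have hQ := isBounded_cyl hΩ T
  refine derivGrowth_of_coord (integrableOn_of_memLp hΩ hp hu.memLp) (fun i G hG => ?_)
    fun G hG => ?_
  · have h1 : Growth (cyl Ω T) b δ h (Du i) (γ - 1) :=
      (hu.derivGrowth_Du hΩ hp (by linarith) i b δ h).growth
        (integrableOn_of_memLp hΩ hp (hu.memLp_Du i)) (by linarith)
    simpa using (hu.deriv_Du i).growth_ex hQ h1 G hG
  · simpa using hu.deriv_ut.growth_et hQ (growth_of_memLp hp hu.memLp_ut b δ h hγ') G hG

lemma IsWeakDeriv.congr_ae {n : ℕ} {Q : Set (ST n)} {e : ST n} {u v v' : ST n → ℝ}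
    (h : IsWeakDeriv Q e u v) (hv : v =ᵐ[volume.restrict Q] v')
    (hv' : LocallyIntegrableOn v' Q) : IsWeakDeriv Q e u v' where
  locInt := h.locInt
  locInt_deriv := hv'
  integral_eq := fun η h1 h2 h3 => by
    rw [h.integral_eq η h1 h2 h3]
    congr 1
    exact integral_congr_ae (hv.mono fun z hz => by simp only [hz])

end ParabolicPoincare

end

open ParabolicPoincare in
theorem corollary1 (n : ℕ) (hn : 3 ≤ n) (Ω : Set (E n)) (hΩ : IsBoundedC21Domain Ω)
    (T : ℝ) (hT : 0 < T) (p : ℝ)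
    (a : Fin n → Fin n → ST n → ℝ) (l : Fin n → ST n → ℝ)
    (f : ST n → ℝ) (ψ : E n → ℝ) (φ : ST n → ℝ)
    (u : ST n → ℝ) (hu : IsStrongSolution Ω T p a l f ψ φ u) :
    (((n : ℝ) + 2) / 2 < p → p ≤ (n : ℝ) + 2 →
      ∀ α : ℝ, 0 < α → α < 2 - ((n : ℝ) + 2) / p →
        ∃ v : ST n → ℝ, u =ᵐ[cylMeasure Ω T] v ∧
          ParabolicHolderOn α v (closure (cyl Ω T))) ∧
    ((n : ℝ) + 2 < p →
      ∀ β : ℝ, 0 < β → β < 1 - ((n : ℝ) + 2) / p →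
        ∃ v : Fin n → ST n → ℝ, ∀ i : Fin n,
          IsWeakDeriv (cyl Ω T) (ex i) u (v i) ∧
          ParabolicHolderOn β (v i) (closure (cyl Ω T))) := by
  obtain ⟨Du, D2u, ut, hW, -⟩ := hu
  have hn' : (3 : ℝ) ≤ n := by exact_mod_cast hn
  refine ⟨fun hp hp' α hα hα' => ?_, fun hp β hβ hβ' => ?_⟩
  · have hp1 : 1 ≤ p := by linarith
    have hκ : 1 ≤ ((n : ℝ) + 2) / p := by rwa [le_div_iff₀ (by linarith), one_mul]
    exact exists_holder_of_derivGrowth hΩ hT hα (by linarith)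
      (integrableOn_of_memLp hΩ hp1 hW.memLp)
      (hW.derivGrowth hΩ hp1 hα'.le (by linarith))
  · have hp1 : 1 ≤ p := by linarith
    have hκ : 0 ≤ ((n : ℝ) + 2) / p := by positivity
    choose v hv hhol using fun i => exists_holder_of_derivGrowth hΩ hT hβ (by linarith)
      (integrableOn_of_memLp hΩ hp1 (hW.memLp_Du i)) (hW.derivGrowth_Du hΩ hp1 hβ'.le i)
    refine ⟨v, fun i => ⟨(hW.deriv_Du i).congr_ae (hv i) ?_, hhol i⟩⟩
    exact IntegrableOn.locallyIntegrableOn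
      ((integrableOn_of_memLp hΩ hp1 (hW.memLp_Du i)).congr (hv i))
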